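/- **Conventions.** For a preadditive category $\mathcal C$, let $\operatorname{Mod}\mathcal C$ be the category of right $\mathcal C$-modules, i.e. of additive functors $\mathcal C^{\mathrm{op}}\to\mathrm{Ab}$. A $\mathcal C$-module $M$ is *flat* if the functor $M\otimes_{\mathcal C}-$ from additive functors $\mathcal C\to\mathrm{Ab}$ to $\mathrm{Ab}$ is exact; here $M\otimes_{\mathcal C}N$ is the quotient of $\bigoplus_{c\in\mathcal C}M(c)\otimes_{\mathbb Z}N(c)$ by the subgroup generated by all $M(f)(x)\otimes y-x\otimes N(f)(y)$ with $f\colon c\to d$ in $\mathcal C$, $x\in M(d)$, $y\in N(c)$. If $\mathcal C$ is triangulated, $M$ is a *homological functor* if it sends every distinguished triangle $X\to Y\to Z\to\Sigma X$ to an exact sequence $M(Z)\to M(Y)\to M(X)$. A *Gorenstein category* is a Grothendieck abelian category $\mathcal A$ such that (1) an object has finite projective dimension if and only if it has finite injective dimension; (2) the *finitary projective dimension* of $\mathcal A$ (the supremum of the projective dimensions of the objects of finite projective dimension) and the *finitary injective dimension* of $\mathcal A$ (defined dually) are finite; (3) $\mathcal A$ has a generator of finite projective dimension. An object is *Gorenstein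 projective* if it is the object of $0$-cycles of an acyclic complex of projectives which remains acyclic under $\operatorname{Hom}(-,Q)$ for every projective $Q$. The *Gorenstein projective dimension* of an object is the least $k\ge 0$ such that a $k$-th syzygy of it (the kernel at the end of $k$ steps of a projective resolution) is Gorenstein projective, and $\infty$ if there is no such $k$. *Gorenstein injective* objects and the *Gorenstein injective dimension* are defined dually, and the *global* Gorenstein projective (injective) dimension of $\mathcal A$ is the supremum over all objects. We say that $\mathcal A$ is *Gorenstein of dimension $m\in\mathbb N$* if it is a Gorenstein category and its finitary projective, finitary injective, global Gorenstein projective and global Gorenstein injective dimensions are all equal to $m$ (suprema are taken in $\mathbb N\cup\{\infty\}$, so that zero objects contribute $0$). **Theorem.** Let $n\ge 0$ be an integer and let $\mathcal C$ be a triangulated category admitting a skeleton with at most $\aleph_n$ morphisms. Then $\operatorname{Mod}\mathcal C$ is Gorenstein of dimension $m$ for some $m\le n+1$. Moreover, for every $\mathcal C$-module $M$ the following are equivalent: $M$ has finite projective dimension; $M$ is flat; $M$ is a homological functor. -/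

import Mathlib

open CategoryTheory CategoryTheory.Limits
open scoped CategoryTheory.Pretriangulated.Opposite TensorProduct DirectSum ZeroObject

universe w v u

section ModuleCategories

variable (C : Type u) [Category.{v} C] [Preadditive C]

/-- The category `Mod C` of right `C`-modules: additive functors from `Cᵒᵖ` to abelian groups. -/
abbrev RightMod := Cᵒᵖ ⥤+ AddCommGrpCat.{v}

/-- The category of left `C`-modules: additive functors from `C` to abelian groups. -/
abbrev LeftMod := C ⥤+ AddCommGrpCat.{v}

instance additiveFunctor_isClosedUnderSubobjects :
    (additiveFunctor C AddCommGrpCat.{v}).IsClosedUnderSubobjects where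
  prop_of_mono {F G} i _ hG := by
    have : G.Additive := hG
    refine ⟨fun {X Y f g} => ?_⟩
    rw [← cancel_mono (i.app Y)]
    simp only [NatTrans.naturality, Preadditive.add_comp, Functor.map_add, Preadditive.comp_add]

instance additiveFunctor_isClosedUnderQuotients :
    (additiveFunctor C AddCommGrpCat.{v}).IsClosedUnderQuotients where
  prop_of_epi {F G} p _ hF := by
    have : F.Additive := hF
    refine ⟨fun {X Y f g} => ?_⟩
    rw [← cancel_epi (p.app X)]
    simp only [← NatTrans.naturality, Preadditive.add_comp, Functor.map_add, Preadditive.comp_add]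

instance additiveFunctor_isClosedUnderFiniteProducts :
    (additiveFunctor C AddCommGrpCat.{v}).IsClosedUnderFiniteProducts where
  isClosedUnderLimitsOfShape J _ := ⟨by
    rintro F ⟨p⟩
    refine ⟨fun {X Y f g} => ?_⟩
    refine (isLimitOfPreserves ((evaluation C AddCommGrpCat.{v}).obj Y) p.isLimit).hom_ext
      fun j => ?_
    have : (p.diag.obj j).Additive := p.prop_diag_obj j
    change F.map (f + g) ≫ (p.π.app j).app Y = (F.map f + F.map g) ≫ (p.π.app j).app Y
    rw [NatTrans.naturality, Preadditive.add_comp, NatTrans.naturality, NatTrans.naturality,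
      ← Preadditive.comp_add]
    congr 1
    exact Functor.map_add _⟩

instance additiveFunctor_containsZero :
    (additiveFunctor C AddCommGrpCat.{v}).ContainsZero where
  exists_zero := ⟨_, isZero_zero _, Functor.Additive.of_isZero (isZero_zero _)⟩

end ModuleCategories

section TensorAndFlatness

variable {C : Type u} [Category.{v} C] [Preadditive C]

/-- The direct sum, over all objects `c` of `C`, of the abelian groups `M(c) ⊗ N(c)`. -/
abbrev TensorSum (M : RightMod C) (N : LeftMod C) : Type (max u v) :=
  ⨁ c : C, (M.obj.obj (Opposite.op c) ⊗[ℤ] N.obj.obj c)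

open Classical in
/-- The element of `⨁ c, M(c) ⊗ N(c)` given by `x ⊗ y` in the component of index `c`. -/
noncomputable def TensorSum.tmul (M : RightMod C) (N : LeftMod C) (c : C)
    (x : M.obj.obj (Opposite.op c)) (y : N.obj.obj c) : TensorSum M N :=
  DirectSum.of (fun c : C => M.obj.obj (Opposite.op c) ⊗[ℤ] N.obj.obj c) c (x ⊗ₜ[ℤ] y)

/-- The subgroup of `⨁ c, M(c) ⊗ N(c)` generated by the elements `M(f)(x) ⊗ y - x ⊗ N(f)(y)`, for
`f : c ⟶ d` in `C`, `x ∈ M(d)` and `y ∈ N(c)`. -/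
noncomputable def tensorRelations (M : RightMod C) (N : LeftMod C) :
    AddSubgroup (TensorSum M N) :=
  AddSubgroup.closure
    {t | ∃ (c d : C) (f : c ⟶ d) (x : M.obj.obj (Opposite.op d)) (y : N.obj.obj c),
      t = TensorSum.tmul M N c (M.obj.map f.op x) y - TensorSum.tmul M N d x (N.obj.map f y)}

/-- The tensor product `M ⊗_C N` of a right `C`-module and a left `C`-module. -/
abbrev ModTensor (M : RightMod C) (N : LeftMod C) : Type (max u v) :=
  TensorSum M N ⧸ tensorRelations M N

/-- The map `⨁ c, M(c) ⊗ N(c) → ⨁ c, M(c) ⊗ N'(c)` induced by `φ : N ⟶ N'`. -/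
noncomputable def tensorSumMap (M : RightMod C) {N N' : LeftMod C} (φ : N ⟶ N') :
    TensorSum M N →+ TensorSum M N' :=
  DirectSum.map fun c =>
    (LinearMap.lTensor (M.obj.obj (Opposite.op c))
      (φ.hom.app c).hom.toIntLinearMap).toAddMonoidHom

lemma tensorSumMap_tmul (M : RightMod C) {N N' : LeftMod C} (φ : N ⟶ N') (c : C)
    (x : M.obj.obj (Opposite.op c)) (y : N.obj.obj c) :
    tensorSumMap M φ (TensorSum.tmul M N c x y) = TensorSum.tmul M N' c x (φ.hom.app c y) := by
  classical
  unfold tensorSumMap TensorSum.tmul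
  rw [DirectSum.map_of]
  rfl

lemma tensorRelations_le_comap (M : RightMod C) {N N' : LeftMod C} (φ : N ⟶ N') :
    tensorRelations M N ≤ (tensorRelations M N').comap (tensorSumMap M φ) := by
  refine (AddSubgroup.closure_le _).2 ?_
  rintro _ ⟨c, d, f, x, y, rfl⟩
  refine AddSubgroup.subset_closure ⟨c, d, f, x, φ.hom.app c y, ?_⟩
  rw [map_sub, tensorSumMap_tmul, tensorSumMap_tmul, NatTrans.naturality_apply φ.hom f y]

/-- The map `M ⊗_C φ : M ⊗_C N → M ⊗_C N'` induced by a morphism `φ : N ⟶ N'`. -/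
noncomputable def modTensorMap (M : RightMod C) {N N' : LeftMod C} (φ : N ⟶ N') :
    ModTensor M N →+ ModTensor M N' :=
  QuotientAddGroup.map (tensorRelations M N) (tensorRelations M N') (tensorSumMap M φ)
    (tensorRelations_le_comap M φ)

/-- A right `C`-module `M` is flat if the functor `M ⊗_C -` is exact; as this functor is always
right exact, this means that it sends injective morphisms of left modules to injective maps. -/
def IsFlatMod (M : RightMod C) : Prop :=
  ∀ ⦃N N' : LeftMod C⦄ (φ : N ⟶ N'), (∀ c : C, Function.Injective (φ.hom.app c)) →
    Function.Injective (modTensorMap M φ)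

end TensorAndFlatness

section Gorenstein

variable {A : Type u} [Category.{v} A] [Abelian A]

/-- `X` has finite projective dimension. -/
def HasFiniteProjDim (X : A) : Prop := ∃ d : ℕ, HasProjectiveDimensionLE X d

/-- `X` has finite injective dimension. -/
def HasFiniteInjDim (X : A) : Prop := ∃ d : ℕ, HasInjectiveDimensionLE X d

/-- `X` is Gorenstein projective: it is the object of `0`-cycles of a complete projective
resolution, i.e. of an acyclic complex of projectives which stays acyclic under `Hom(-, Q)` for
every projective object `Q`. -/
def IsGorensteinProjective (X : A) : Prop :=
  ∃ K : CochainComplex A ℤ, (∀ i, Projective (K.X i)) ∧ K.Acyclic ∧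
    (∀ (Q : A) [Projective Q] (i : ℤ) (f : K.X i ⟶ Q), K.d (i - 1) i ≫ f = 0 →
      ∃ g : K.X (i + 1) ⟶ Q, K.d i (i + 1) ≫ g = f) ∧
    Nonempty (X ≅ K.cycles 0)

/-- `X` is Gorenstein injective: it is the object of `0`-cycles of a complete injective
resolution, i.e. of an acyclic complex of injectives which stays acyclic under `Hom(J, -)` for
every injective object `J`. -/
def IsGorensteinInjective (X : A) : Prop :=
  ∃ K : CochainComplex A ℤ, (∀ i, Injective (K.X i)) ∧ K.Acyclic ∧
    (∀ (J : A) [Injective J] (i : ℤ) (f : J ⟶ K.X i), f ≫ K.d i (i + 1) = 0 →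
      ∃ g : J ⟶ K.X (i - 1), g ≫ K.d (i - 1) i = f) ∧
    Nonempty (X ≅ K.cycles 0)

/-- `IsSyzygy k X Y`: the object `Y` is a `k`-th syzygy of `X`, i.e. there is an exact sequence
`0 ⟶ Y ⟶ P_{k-1} ⟶ ⋯ ⟶ P_0 ⟶ X ⟶ 0` with all `P_i` projective. -/
def IsSyzygy : ℕ → A → A → Prop
  | 0, X, Y => Nonempty (Y ≅ X)
  | k + 1, X, Y => ∃ S : ShortComplex A,
      S.ShortExact ∧ Projective S.X₂ ∧ Nonempty (Y ≅ S.X₁) ∧ IsSyzygy k X S.X₃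

/-- `IsCosyzygy k X Y`: the object `Y` is a `k`-th cosyzygy of `X`, i.e. there is an exact
sequence `0 ⟶ X ⟶ I^0 ⟶ ⋯ ⟶ I^{k-1} ⟶ Y ⟶ 0` with all `I^i` injective. -/
def IsCosyzygy : ℕ → A → A → Prop
  | 0, X, Y => Nonempty (Y ≅ X)
  | k + 1, X, Y => ∃ S : ShortComplex A,
      S.ShortExact ∧ Injective S.X₂ ∧ Nonempty (Y ≅ S.X₃) ∧ IsCosyzygy k X S.X₁

/-- The Gorenstein projective dimension of `X` is at most `k`: for some `j ≤ k`, a `j`-th syzygy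
of `X` is Gorenstein projective. -/
def HasGorensteinProjDimLE (X : A) (k : ℕ) : Prop :=
  ∃ j ≤ k, ∃ Y : A, IsSyzygy j X Y ∧ IsGorensteinProjective Y

/-- The Gorenstein injective dimension of `X` is at most `k`. -/
def HasGorensteinInjDimLE (X : A) (k : ℕ) : Prop :=
  ∃ j ≤ k, ∃ Y : A, IsCosyzygy j X Y ∧ IsGorensteinInjective Y

variable (A)

/-- The finitary projective dimension of `A` is at most `k`. -/
def FinitaryProjDimLE (k : ℕ) : Prop :=
  ∀ X : A, HasFiniteProjDim X → HasProjectiveDimensionLE X k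

/-- The finitary injective dimension of `A` is at most `k`. -/
def FinitaryInjDimLE (k : ℕ) : Prop :=
  ∀ X : A, HasFiniteInjDim X → HasInjectiveDimensionLE X k

/-- A Gorenstein category. The universe `w` is the size of the filtered colimits in the
definition of a Grothendieck category. -/
structure IsGorensteinCategory : Prop where
  isGrothendieck : IsGrothendieckAbelian.{w} A
  finite_projDim_iff (X : A) : HasFiniteProjDim X ↔ HasFiniteInjDim X
  finitaryProjDim_finite : ∃ k, FinitaryProjDimLE A k
  finitaryInjDim_finite : ∃ k, FinitaryInjDimLE A k
  exists_generator : ∃ G : A, IsSeparator G ∧ HasFiniteProjDim G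

/-- `A` is a Gorenstein category of Gorenstein dimension `m`: it is a Gorenstein category, and
its finitary projective, finitary injective, global Gorenstein projective and global Gorenstein
injective dimensions are all equal to the natural number `m`. -/
structure IsGorensteinOfDim (m : ℕ) : Prop where
  isGorenstein : IsGorensteinCategory.{w} A
  finitaryProjDim_eq : IsLeast {k | FinitaryProjDimLE A k} m
  finitaryInjDim_eq : IsLeast {k | FinitaryInjDimLE A k} m
  gorensteinProjDim_eq : IsLeast {k | ∀ X : A, HasGorensteinProjDimLE X k} m
  gorensteinInjDim_eq : IsLeast {k | ∀ X : A, HasGorensteinInjDimLE X k} m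

end Gorenstein

/-!
Let `C` be a triangulated category with a skeleton of at most `ℵ_n` morphisms. The proof shows
that for a right `C`-module `M` each of the conditions

* `M` is a homological functor,
* `M` has finite projective dimension,
* `M` has finite injective dimension,
* `M` is flat

is equivalent to the others, and that the two dimensions are then at most `n + 1`. The rest is
formal.

**Finite dimension implies homological.** Representable modules are homological, hence so are free
and projective modules. Injective modules are homological since `Hom(-, E)` is exact on the exact
sequences of representable modules given by triangles. A diagram chase along the rotated triangles
(`RightMod.isHomological_X₃`, `RightMod.isHomological_X₁`) passes to modules of finite dimension.

**Homological implies finite dimension.** Let `M` be homological. For a triangle `z ⟶ a ⟶ b`, the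
image of `Hom(-, a) ⟶ Hom(-, b)` is the cokernel of `Hom(-, z) ⟶ Hom(-, a)`, and morphisms from it
to `M` extend to `Hom(-, b)`. Dimension shifting shows that `M` has no higher extensions by
finitely presented modules (`RightMod.subsingleton_ext_cokernel_repMap`), nor by the quotients of a
free module by finitely generated submodules. There is a free generator with at most `ℵ_n`
elements. Its submodules are sums of at most `ℵ_n` cyclic ones, and an induction on the cardinal
based on Eklof's lemma shows that each passage from `ℵ_d` to `ℵ_{d+1}` costs one degree of
extensions (`subsingleton_ext_cokernel_iSup_of_lt_aleph`). Baer's criterion then bounds the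
injective dimension by `n + 1` (`RightMod.hasInjectiveDimensionLE_of_isHomological`). As the class
of homological functors is closed under syzygies, a projective resolution of `M` splits at its
syzygy of degree `n + 1`, so the projective dimension of `M` has the same bound
(`hasProjectiveDimensionLE_of_injDim`).

**Gorenstein dimensions.** In an abelian category with enough projectives and injectives, in which
finite projective and finite injective dimension agree, all four dimensions in the definition of
Gorenstein dimension are governed by the finitary projective dimension. If the latter is at most
`k`, then the `k`-th syzygies form a class in which every object embeds in a projective with
quotient in the class, by the horseshoe lemma applied to `0 ⟶ X ⟶ I ⟶ X' ⟶ 0`. Splicing produces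
complete resolutions. Conversely, Gorenstein projective objects of finite projective dimension are
projective. The injective case follows in the opposite category. See `exists_isGorensteinOfDim`.

**Flat and homological.** If `M` is homological, its category of elements is filtered
(`RightMod.isFiltered_el`), so `M ⊗_C -` is a filtered colimit of evaluations. Conversely, for a
triangle `X ⟶ Y ⟶ Z`, flatness is applied to the inclusion in `Hom(X, -)` of the image of
`Hom(Y, -)` (`RightMod.exists_map_eq_of_isFlatMod`).
-/

/-! ### Vanishing of `Ext`, extension of morphisms and dimension shifting -/

section ExtAndExtension

open Abelian

variable {A : Type u} [Category.{v} A] [Abelian A] [HasExt.{w} A]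
  {S : ShortComplex A} (hS : S.ShortExact)

include hS

lemma exists_lift_of_subsingleton_ext_one {Y : A} (h : Subsingleton (Ext Y S.X₁ 1))
    (f : Y ⟶ S.X₃) : ∃ g : Y ⟶ S.X₂, g ≫ S.g = f := by
  obtain ⟨x, hx⟩ := Ext.covariant_sequence_exact₃ Y hS (Ext.mk₀ f) (zero_add 1)
    (Subsingleton.elim _ _)
  obtain ⟨g, rfl⟩ := Ext.homEquiv₀.symm.surjective x
  exact ⟨g, Ext.homEquiv₀.symm.injective (by simpa using hx)⟩

lemma exists_extend_of_subsingleton_ext_one {Z : A} (h : Subsingleton (Ext S.X₃ Z 1))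
    (f : S.X₁ ⟶ Z) : ∃ g : S.X₂ ⟶ Z, S.f ≫ g = f := by
  obtain ⟨x, hx⟩ := Ext.contravariant_sequence_exact₁ hS Z (Ext.mk₀ f) (add_zero 1)
    (Subsingleton.elim _ _)
  obtain ⟨g, rfl⟩ := Ext.homEquiv₀.symm.surjective x
  exact ⟨g, Ext.homEquiv₀.symm.injective (by simpa using hx)⟩

lemma subsingleton_ext_one_of_extend [Projective S.X₂] {Z : A}
    (h : ∀ f : S.X₁ ⟶ Z, ∃ g : S.X₂ ⟶ Z, S.f ≫ g = f) : Subsingleton (Ext S.X₃ Z 1) := by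
  refine subsingleton_of_forall_eq 0 fun x => ?_
  obtain ⟨y, rfl⟩ := Ext.contravariant_sequence_exact₃ hS Z x (Ext.eq_zero_of_projective _)
    (add_zero 1)
  obtain ⟨f, rfl⟩ := Ext.homEquiv₀.symm.surjective y
  obtain ⟨g, rfl⟩ := h f
  simp only [Ext.homEquiv₀_symm_apply]
  rw [← Ext.mk₀_comp_mk₀, ← Ext.comp_assoc _ _ _ (add_zero 1) (zero_add 0) (by simp)]
  simp

lemma subsingleton_ext_one_of_lift [Injective S.X₂] {Y : A}
    (h : ∀ f : Y ⟶ S.X₃, ∃ g : Y ⟶ S.X₂, g ≫ S.g = f) : Subsingleton (Ext Y S.X₁ 1) := by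
  refine subsingleton_of_forall_eq 0 fun x => ?_
  obtain ⟨y, rfl⟩ := Ext.covariant_sequence_exact₁ Y hS x (Ext.eq_zero_of_injective _)
    (zero_add 1)
  obtain ⟨f, rfl⟩ := Ext.homEquiv₀.symm.surjective y
  obtain ⟨g, rfl⟩ := h f
  simp only [Ext.homEquiv₀_symm_apply]
  rw [← Ext.mk₀_comp_mk₀, Ext.comp_assoc _ _ _ (zero_add 0) (zero_add 1) (by simp)]
  simp

/-- Dimension shifting in the first variable along a projective object. -/
lemma subsingleton_ext_shift_left [Projective S.X₂] (Z : A) (i : ℕ) :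
    Subsingleton (Ext S.X₃ Z (i + 2)) ↔ Subsingleton (Ext S.X₁ Z (i + 1)) := by
  constructor
  · intro h
    refine subsingleton_of_forall_eq 0 fun x => ?_
    obtain ⟨y, rfl⟩ := Ext.contravariant_sequence_exact₁ hS Z x (by ring : 1 + (i + 1) = i + 2)
      (Subsingleton.elim _ _)
    rw [Ext.eq_zero_of_projective y, Ext.comp_zero]
  · intro h
    refine subsingleton_of_forall_eq 0 fun x => ?_
    obtain ⟨y, rfl⟩ := Ext.contravariant_sequence_exact₃ hS Z x (Ext.eq_zero_of_projective _)
      (by ring : 1 + (i + 1) = i + 2)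
    rw [Subsingleton.elim y 0, Ext.comp_zero]

/-- Dimension shifting in the second variable along an injective object. -/
lemma subsingleton_ext_shift_right [Injective S.X₂] (Y : A) (i : ℕ) :
    Subsingleton (Ext Y S.X₁ (i + 2)) ↔ Subsingleton (Ext Y S.X₃ (i + 1)) := by
  constructor
  · intro h
    refine subsingleton_of_forall_eq 0 fun x => ?_
    obtain ⟨y, rfl⟩ := Ext.covariant_sequence_exact₃ Y hS x (by ring : (i + 1) + 1 = i + 2)
      (Subsingleton.elim _ _)
    rw [Ext.eq_zero_of_injective y, Ext.zero_comp]
  · intro h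
    refine subsingleton_of_forall_eq 0 fun x => ?_
    obtain ⟨y, rfl⟩ := Ext.covariant_sequence_exact₁ Y hS x (Ext.eq_zero_of_injective _)
      (by ring : (i + 1) + 1 = i + 2)
    rw [Subsingleton.elim y 0, Ext.zero_comp]

lemma subsingleton_ext_X₁ {Z : A} {i : ℕ} (h₂ : Subsingleton (Ext S.X₂ Z i))
    (h₃ : Subsingleton (Ext S.X₃ Z (i + 1))) : Subsingleton (Ext S.X₁ Z i) := by
  refine subsingleton_of_forall_eq 0 fun x => ?_
  obtain ⟨y, rfl⟩ := Ext.contravariant_sequence_exact₁ hS Z x (add_comm 1 i)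
    (Subsingleton.elim _ _)
  rw [Subsingleton.elim y 0, Ext.comp_zero]

lemma subsingleton_ext_X₂ {Z : A} {i : ℕ} (h₁ : Subsingleton (Ext S.X₁ Z i))
    (h₃ : Subsingleton (Ext S.X₃ Z i)) : Subsingleton (Ext S.X₂ Z i) := by
  refine subsingleton_of_forall_eq 0 fun x => ?_
  obtain ⟨y, rfl⟩ := Ext.contravariant_sequence_exact₂ hS Z x (Subsingleton.elim _ _)
  rw [Subsingleton.elim y 0, Ext.comp_zero]

lemma subsingleton_ext_right_X₃ {Y : A} {i : ℕ} (h₂ : Subsingleton (Ext Y S.X₂ i))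
    (h₁ : Subsingleton (Ext Y S.X₁ (i + 1))) : Subsingleton (Ext Y S.X₃ i) := by
  refine subsingleton_of_forall_eq 0 fun x => ?_
  obtain ⟨y, rfl⟩ := Ext.covariant_sequence_exact₃ Y hS x rfl (Subsingleton.elim _ _)
  rw [Subsingleton.elim y 0, Ext.zero_comp]

omit hS in
lemma subsingleton_ext_of_iso_left {X Y : A} (e : X ≅ Y) (Z : A) (i : ℕ)
    (h : Subsingleton (Ext X Z i)) : Subsingleton (Ext Y Z i) := by
  refine subsingleton_of_forall_eq 0 fun x => ?_
  rw [← x.mk₀_id_comp, ← e.inv_hom_id, ← Ext.mk₀_comp_mk₀, Ext.comp_assoc_of_second_deg_zero,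
    Subsingleton.elim ((Ext.mk₀ e.hom).comp x (zero_add i)) 0, Ext.comp_zero]

end ExtAndExtension

section Presentations

variable {A : Type u} [Category.{v} A] [Abelian A]

lemma exists_shortExact_projective [EnoughProjectives A] (X : A) :
    ∃ S : ShortComplex A, S.ShortExact ∧ Projective S.X₂ ∧ S.X₃ = X :=
  ⟨ShortComplex.mk _ _ (kernel.condition (Projective.π X)),
    { exact := ShortComplex.exact_of_f_is_kernel _ (kernelIsKernel _) },
    inferInstanceAs (Projective (Projective.over X)), rfl⟩

lemma exists_shortExact_injective [EnoughInjectives A] (X : A) :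
    ∃ S : ShortComplex A, S.ShortExact ∧ Injective S.X₂ ∧ S.X₁ = X :=
  ⟨ShortComplex.mk _ _ (cokernel.condition (Injective.ι X)),
    { exact := ShortComplex.exact_of_g_is_cokernel _ (cokernelIsCokernel _) },
    inferInstanceAs (Injective (Injective.under X)), rfl⟩

lemma projective_of_lift {S : ShortComplex A} [Projective S.X₂]
    (h : ∃ s : S.X₃ ⟶ S.X₂, s ≫ S.g = 𝟙 _) : Projective S.X₃ := by
  obtain ⟨s, hs⟩ := h
  exact Retract.projective { i := s, r := S.g, retract := hs }

end Presentations

/-! ### Homological dimensions in the opposite category -/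

section Opposite

variable {A : Type u} [Category.{v} A] [Abelian A]

lemma hasProjectiveDimensionLE_op_iff [EnoughInjectives A] (n : ℕ) (X : A) :
    HasProjectiveDimensionLE (Opposite.op X) n ↔ HasInjectiveDimensionLE X n := by
  induction n generalizing X with
  | zero =>
    change HasProjectiveDimensionLT _ 1 ↔ HasInjectiveDimensionLT _ 1
    rw [← projective_iff_hasProjectiveDimensionLT_one, ← injective_iff_hasInjectiveDimensionLT_one]
    exact Injective.injective_iff_projective_op.symm
  | succ n ih =>
    obtain ⟨S, hS, h₂, rfl⟩ := exists_shortExact_injective X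
    have : Projective S.op.X₂ := Injective.injective_iff_projective_op.1 h₂
    exact (hS.op.hasProjectiveDimensionLT_X₃_iff n this).trans
      ((ih S.X₃).trans (hS.hasInjectiveDimensionLT_X₃_iff n h₂))

lemma hasInjectiveDimensionLE_op_iff [EnoughProjectives A] (n : ℕ) (X : A) :
    HasInjectiveDimensionLE (Opposite.op X) n ↔ HasProjectiveDimensionLE X n := by
  induction n generalizing X with
  | zero =>
    change HasInjectiveDimensionLT _ 1 ↔ HasProjectiveDimensionLT _ 1
    rw [← projective_iff_hasProjectiveDimensionLT_one, ← injective_iff_hasInjectiveDimensionLT_one]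
    exact Injective.projective_iff_injective_op.symm
  | succ n ih =>
    obtain ⟨S, hS, h₂, rfl⟩ := exists_shortExact_projective X
    have : Injective S.op.X₂ := Injective.projective_iff_injective_op.1 h₂
    exact (hS.op.hasInjectiveDimensionLT_X₃_iff n this).symm.trans
      ((ih S.X₁).trans (hS.hasProjectiveDimensionLT_X₃_iff n h₂).symm)

end Opposite

/-! ### Syzygies and the horseshoe lemma -/

section Syzygies

open Abelian

variable {A : Type u} [Category.{v} A] [Abelian A]

lemma exists_isSyzygy [EnoughProjectives A] (k : ℕ) (X : A) : ∃ Y, IsSyzygy k X Y := by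
  induction k with
  | zero => exact ⟨X, ⟨Iso.refl _⟩⟩
  | succ k ih =>
    obtain ⟨Z, hZ⟩ := ih
    obtain ⟨S, hS, h₂, rfl⟩ := exists_shortExact_projective Z
    exact ⟨S.X₁, S, hS, h₂, ⟨Iso.refl _⟩, hZ⟩

lemma IsSyzygy.hasProjectiveDimensionLE_iff {k : ℕ} {X Y : A} (h : IsSyzygy k X Y) (n : ℕ) :
    HasProjectiveDimensionLE X (n + k) ↔ HasProjectiveDimensionLE Y n := by
  induction k generalizing Y n with
  | zero =>
    obtain ⟨e⟩ := h
    exact ⟨fun _ => hasProjectiveDimensionLT_of_iso e.symm _,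
      fun _ => hasProjectiveDimensionLT_of_iso e _⟩
  | succ k ih =>
    obtain ⟨S, hS, h₂, ⟨e⟩, h'⟩ := h
    rw [show n + (k + 1) = (n + 1) + k by ring, ih h' (n + 1)]
    refine (hS.hasProjectiveDimensionLT_X₃_iff n h₂).trans
      ⟨fun _ => hasProjectiveDimensionLT_of_iso e.symm _,
        fun _ => hasProjectiveDimensionLT_of_iso e _⟩

lemma IsSyzygy.subsingleton_ext [HasExt.{w} A] {k : ℕ} {X Y : A} (h : IsSyzygy k X Y) (Z : A)
    (i : ℕ) (hX : Subsingleton (Ext X Z (i + k + 1))) : Subsingleton (Ext Y Z (i + 1)) := by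
  induction k generalizing Y i with
  | zero => exact subsingleton_ext_of_iso_left h.some.symm Z _ hX
  | succ k ih =>
    obtain ⟨S, hS, h₂, ⟨e⟩, h'⟩ := h
    refine subsingleton_ext_of_iso_left e.symm Z _ ?_
    rw [← subsingleton_ext_shift_left hS]
    refine ih h' (i + 1) ?_
    rwa [show i + 1 + k + 1 = i + (k + 1) + 1 by ring]

/-- An iterated syzygy is an iterated syzygy of a first syzygy. -/
lemma IsSyzygy.exists_of_succ {k : ℕ} {X Y : A} (h : IsSyzygy (k + 1) X Y) :
    ∃ X' : A, IsSyzygy k X' Y := by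
  induction k generalizing Y with
  | zero =>
    obtain ⟨S, -, -, ⟨e⟩, -⟩ := h
    exact ⟨S.X₁, ⟨e⟩⟩
  | succ k ih =>
    obtain ⟨S, hS, h₂, e, h'⟩ := h
    obtain ⟨X', hX'⟩ := ih h'
    exact ⟨X', S, hS, h₂, e, hX'⟩

/-- The kernel sequence of a composition `f ≫ g` with `f` epi. -/
lemma shortExact_kernel_comp {X Y Z : A} (f : X ⟶ Y) (g : Y ⟶ Z) [Epi f] :
    (ShortComplex.mk (kernel.map f (f ≫ g) (𝟙 _) g (by simp))
      (kernel.map (f ≫ g) g f (𝟙 _) (by simp))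
      (by simp [← cancel_mono (kernel.ι g)])).ShortExact := by
  have hm : Mono (kernel.map f (f ≫ g) (𝟙 _) g (by simp)) := by
    refine @mono_of_mono _ _ _ _ _ _ (kernel.ι (f ≫ g)) ?_
    rw [kernel.lift_ι, Category.comp_id]
    infer_instance
  have he : Epi (kernelCokernelCompSequence.snakeInput f g).L₀.g := by
    refine (kernelCokernelCompSequence.snakeInput f g).L₁'_exact.epi_f ?_
    exact (isZero_cokernel_of_epi f).eq_of_tgt _ _
  exact ShortComplex.ShortExact.mk' (kernelCokernelCompSequence.snakeInput f g).L₀_exact hm he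

/-- One step of the horseshoe lemma: a short exact sequence of first syzygies of the terms of
`S`, the first of which is a given one. -/
lemma exists_shortExact_syzygies [EnoughProjectives A] {S T : ShortComplex A}
    (hS : S.ShortExact) (hT : T.ShortExact) [Projective T.X₂] (e : T.X₃ ≅ S.X₁) :
    ∃ R : ShortComplex A, R.ShortExact ∧ Nonempty (T.X₁ ≅ R.X₁) ∧
      (∃ U : ShortComplex A, U.ShortExact ∧ Projective U.X₂ ∧ Nonempty (R.X₂ ≅ U.X₁) ∧
        U.X₃ = S.X₂) ∧
      (∃ U : ShortComplex A, U.ShortExact ∧ Projective U.X₂ ∧ Nonempty (R.X₃ ≅ U.X₁) ∧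
        U.X₃ = S.X₃) := by
  have := hS.epi_g
  have := hS.mono_f
  have := hT.epi_g
  have := hT.mono_f
  -- The epimorphism `T.X₂ ⊞ P' ⟶ S.X₂` factors as `f ≫ g`; the kernels of `f` and `g` are the
  -- given syzygy of `S.X₁` and a syzygy of `S.X₃`.
  let P' := Projective.over S.X₃
  let p' : P' ⟶ S.X₃ := Projective.π S.X₃
  let l : P' ⟶ S.X₂ := Projective.factorThru p' S.g
  have hl : l ≫ S.g = p' := Projective.factorThru_comp _ _
  let f : T.X₂ ⊞ P' ⟶ S.X₁ ⊞ P' := biprod.map (T.g ≫ e.hom) (𝟙 P')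
  let g : S.X₁ ⊞ P' ⟶ S.X₂ := biprod.desc S.f l
  have hf : Epi f := by
    dsimp only [f]
    infer_instance
  have hg : Epi g := by
    rw [Preadditive.epi_iff_cancel_zero]
    intro Z t ht
    have h1 : S.f ≫ t = 0 := by simpa [g] using biprod.inl ≫= ht
    have h2 : l ≫ t = 0 := by simpa [g] using biprod.inr ≫= ht
    obtain ⟨t', rfl⟩ := CokernelCofork.IsColimit.desc' hS.gIsCokernel t h1
    have : p' ≫ t' = 0 := by rw [← hl, Category.assoc]; exact h2
    rw [(cancel_epi p').1 (this.trans comp_zero.symm), comp_zero]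
  have hf₁ : (kernel.ι f ≫ biprod.fst) ≫ T.g = 0 := by
    rw [← cancel_mono e.hom, Category.assoc, Category.assoc,
      ← biprod.map_fst (T.g ≫ e.hom) (𝟙 P'), kernel.condition_assoc, zero_comp, zero_comp]
  have hf₂ : kernel.ι f ≫ biprod.snd = 0 := by
    rw [← Category.comp_id biprod.snd, ← biprod.map_snd (T.g ≫ e.hom) (𝟙 P'),
      kernel.condition_assoc, zero_comp]
  have hgs : g ≫ S.g = biprod.snd ≫ p' := by
    ext <;> simp [g, hl]
  have hm : Mono (kernel.ι g ≫ (biprod.snd : S.X₁ ⊞ P' ⟶ P')) := by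
    rw [Preadditive.mono_iff_cancel_zero]
    intro W k hk
    have h1 : k ≫ kernel.ι g = (k ≫ kernel.ι g ≫ biprod.fst) ≫ biprod.inl := by
      ext <;> simp [hk]
    have h2 : (k ≫ kernel.ι g ≫ biprod.fst) ≫ S.f = 0 := by
      have : k ≫ kernel.ι g ≫ g = 0 := by simp
      rw [← Category.assoc, h1, Category.assoc] at this
      simpa [g] using this
    rw [← cancel_mono (kernel.ι g), h1, (cancel_mono S.f).1 (h2.trans zero_comp.symm)]
    simp
  let e₁ : T.X₁ ≅ kernel f :=
    { hom := kernel.lift f (T.f ≫ biprod.inl) (by simp [f])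
      inv := hT.exact.lift (kernel.ι f ≫ biprod.fst) hf₁
      hom_inv_id := by simp [← cancel_mono T.f]
      inv_hom_id := by
        rw [← cancel_mono (kernel.ι f)]
        ext
        · simp
        · simp [hf₂] }
  refine ⟨_, shortExact_kernel_comp f g, ⟨e₁⟩, ⟨ShortComplex.mk _ _ (kernel.condition (f ≫ g)),
    { exact := ShortComplex.exact_of_f_is_kernel _ (kernelIsKernel _) }, ?_, ⟨Iso.refl _⟩, rfl⟩,
    ⟨ShortComplex.mk (kernel.ι g ≫ biprod.snd) p' ?_, ?_, ?_, ⟨Iso.refl _⟩, rfl⟩⟩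
  · exact inferInstanceAs (Projective (T.X₂ ⊞ P'))
  · rw [Category.assoc, ← hgs, kernel.condition_assoc, zero_comp]
  · refine ShortComplex.ShortExact.mk' (ShortComplex.exact_of_f_is_kernel _
      (KernelFork.IsLimit.ofι' _ _ fun {W} x hx => ?_)) hm (inferInstanceAs (Epi p'))
    have hx' : (x ≫ l) ≫ S.g = 0 := by rw [Category.assoc, hl]; exact hx
    exact ⟨kernel.lift g (biprod.lift (-hS.exact.lift (x ≫ l) hx') x) (by simp [g]), by simp⟩
  · exact inferInstanceAs (Projective (Projective.over S.X₃))

/-- The iterated horseshoe lemma: a `k`-th syzygy of the first term of a short exact sequence is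
the first term of a short exact sequence of `k`-th syzygies. -/
lemma IsSyzygy.exists_shortExact [EnoughProjectives A] {k : ℕ} {S : ShortComplex A}
    (hS : S.ShortExact) {Y : A} (h : IsSyzygy k S.X₁ Y) :
    ∃ R : ShortComplex A, R.ShortExact ∧ Nonempty (Y ≅ R.X₁) ∧ IsSyzygy k S.X₂ R.X₂ ∧
      IsSyzygy k S.X₃ R.X₃ := by
  induction k generalizing Y with
  | zero => exact ⟨S, hS, h, ⟨Iso.refl _⟩, ⟨Iso.refl _⟩⟩
  | succ k ih =>
    obtain ⟨T, hT, h₂, ⟨e⟩, h'⟩ := h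
    obtain ⟨R, hR, ⟨e'⟩, hR₂, hR₃⟩ := ih h'
    obtain ⟨R', hR', ⟨e''⟩, ⟨U, hU, hU₂, hUe, hU₃⟩, ⟨V, hV, hV₂, hVe, hV₃⟩⟩ :=
      exists_shortExact_syzygies hR hT e'
    exact ⟨R', hR', ⟨e ≪≫ e''⟩, ⟨U, hU, hU₂, hUe, hU₃ ▸ hR₂⟩, ⟨V, hV, hV₂, hVe, hV₃ ▸ hR₃⟩⟩

end Syzygies

/-! ### Objects of finite projective or injective dimension -/

section FiniteDimension

open Abelian

variable {A : Type u} [Category.{v} A] [Abelian A]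

lemma hasProjectiveDimensionLE_of_le {X : A} {m n : ℕ} (h : HasProjectiveDimensionLE X m)
    (hmn : m ≤ n) : HasProjectiveDimensionLE X n :=
  hasProjectiveDimensionLT_of_ge X (m + 1) (n + 1) (by lia)

lemma HasFiniteProjDim.of_projective (X : A) [Projective X] : HasFiniteProjDim X :=
  ⟨0, inferInstanceAs (HasProjectiveDimensionLT X 1)⟩

lemma HasFiniteInjDim.of_injective (X : A) [Injective X] : HasFiniteInjDim X :=
  ⟨0, inferInstanceAs (HasInjectiveDimensionLT X 1)⟩

lemma HasFiniteProjDim.of_iso {X Y : A} (e : X ≅ Y) : HasFiniteProjDim X → HasFiniteProjDim Y :=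
  fun ⟨d, _⟩ => ⟨d, hasProjectiveDimensionLT_of_iso e _⟩

lemma HasFiniteProjDim.of_shortExact {S : ShortComplex A} (hS : S.ShortExact)
    [Projective S.X₂] (h : HasFiniteProjDim S.X₃) : HasFiniteProjDim S.X₁ := by
  obtain ⟨d, hd⟩ := h
  exact ⟨d, hS.hasProjectiveDimensionLT_X₁ _ inferInstance
    (hasProjectiveDimensionLE_of_le hd (Nat.le_succ d))⟩

lemma IsSyzygy.hasFiniteProjDim {k : ℕ} {X Y : A} (h : IsSyzygy k X Y)
    (hX : HasFiniteProjDim X) : HasFiniteProjDim Y := by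
  obtain ⟨d, hd⟩ := hX
  exact ⟨d, (h.hasProjectiveDimensionLE_iff d).1
    (hasProjectiveDimensionLE_of_le hd (Nat.le_add_right d k))⟩

lemma hasFiniteProjDim_op_iff [EnoughInjectives A] (X : A) :
    HasFiniteProjDim (Opposite.op X) ↔ HasFiniteInjDim X :=
  exists_congr fun d => hasProjectiveDimensionLE_op_iff d X

lemma hasFiniteInjDim_op_iff [EnoughProjectives A] (X : A) :
    HasFiniteInjDim (Opposite.op X) ↔ HasFiniteProjDim X :=
  exists_congr fun d => hasInjectiveDimensionLE_op_iff d X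

/-- If the objects of a class closed under syzygies have injective dimension at most `d`, then they
also have projective dimension at most `d`: the beginning of a projective resolution splits at its
`d`-th syzygy. -/
lemma hasProjectiveDimensionLE_of_injDim [EnoughProjectives A] (W : A → Prop) (d : ℕ)
    (hW : ∀ S : ShortComplex A, S.ShortExact → Projective S.X₂ → W S.X₃ → W S.X₁)
    (hiso : ∀ {X Y : A}, (X ≅ Y) → W X → W Y)
    (hd : ∀ X, W X → HasInjectiveDimensionLE X d) {X : A} (hX : W X) :
    HasProjectiveDimensionLE X d := by
  let := HasExt.standard A
  have hsyz : ∀ {k : ℕ} {Y : A}, IsSyzygy k X Y → W Y := by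
    intro k
    induction k with
    | zero => exact fun ⟨e⟩ => hiso e.symm hX
    | succ k ih => exact fun ⟨S, hS, h₂, ⟨e⟩, h'⟩ => hiso e.symm (hW S hS h₂ (ih h'))
  obtain ⟨Y, hY⟩ := exists_isSyzygy d X
  obtain ⟨S, hS, h₂, rfl⟩ := exists_shortExact_projective Y
  have := hd _ (hW S hS h₂ (hsyz hY))
  have hp : Projective S.X₃ := projective_of_lift
    (exists_lift_of_subsingleton_ext_one hS (hY.subsingleton_ext S.X₁ 0
      (HasInjectiveDimensionLT.subsingleton S.X₁ (d + 1) _ (by lia) X)) (𝟙 _))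
  have := (hY.hasProjectiveDimensionLE_iff 0).2
    ((projective_iff_hasProjectiveDimensionLE_zero _).1 hp)
  rwa [zero_add] at this

lemma FinitaryInjDimLE.finitaryProjDimLE [EnoughProjectives A]
    (H : ∀ X : A, HasFiniteProjDim X → HasFiniteInjDim X) {k : ℕ} (h : FinitaryInjDimLE A k) :
    FinitaryProjDimLE A k := fun _ hX =>
  hasProjectiveDimensionLE_of_injDim HasFiniteProjDim k (fun _ hS _ h₃ => h₃.of_shortExact hS)
    (fun e => HasFiniteProjDim.of_iso e) (fun Y hY => h Y (H Y hY)) hX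

lemma finitaryProjDimLE_op_iff [EnoughInjectives A] (k : ℕ) :
    FinitaryProjDimLE Aᵒᵖ k ↔ FinitaryInjDimLE A k :=
  ⟨fun h X hX => (hasProjectiveDimensionLE_op_iff k X).1 (h _ ((hasFiniteProjDim_op_iff X).2 hX)),
    fun h X hX => (hasProjectiveDimensionLE_op_iff k X.unop).2
      (h _ ((hasFiniteProjDim_op_iff X.unop).1 hX))⟩

lemma finitaryInjDimLE_op_iff [EnoughProjectives A] (k : ℕ) :
    FinitaryInjDimLE Aᵒᵖ k ↔ FinitaryProjDimLE A k :=
  ⟨fun h X hX => (hasInjectiveDimensionLE_op_iff k X).1 (h _ ((hasFiniteInjDim_op_iff X).2 hX)),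
    fun h X hX => (hasInjectiveDimensionLE_op_iff k X.unop).2
      (h _ ((hasFiniteInjDim_op_iff X.unop).1 hX))⟩

/-- The finitary projective and injective dimensions agree, provided that they are taken over the
same objects. -/
lemma finitaryInjDimLE_iff [EnoughProjectives A] [EnoughInjectives A]
    (H : ∀ X : A, HasFiniteProjDim X ↔ HasFiniteInjDim X) (k : ℕ) :
    FinitaryInjDimLE A k ↔ FinitaryProjDimLE A k := by
  refine ⟨fun h => h.finitaryProjDimLE fun X => (H X).1, fun h => ?_⟩
  rw [← finitaryProjDimLE_op_iff]
  refine ((finitaryInjDimLE_op_iff k).2 h).finitaryProjDimLE fun X hX => ?_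
  exact (hasFiniteInjDim_op_iff X.unop).2 ((H _).2 ((hasFiniteProjDim_op_iff X.unop).1 hX))

end FiniteDimension

/-! ### Classes of objects closed under syzygies and cosyzygies -/

section GorensteinProjective

open Abelian

variable {A : Type u} [Category.{v} A] [Abelian A]

/-- A class `G` of objects is *spliceable* for a property `E` of short complexes if each of its
objects is, up to isomorphism, both the first term and the last term of short complexes
satisfying `E` whose other outer term belongs to `G` again. Splicing such short exact sequences
yields acyclic complexes with cycles in `G`, see `IsSpliceable.exists_sequence`. -/
structure IsSpliceable (E : ShortComplex A → Prop) (G : A → Prop) : Prop where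
  next (X : A) : G X → ∃ S, E S ∧ Nonempty (X ≅ S.X₁) ∧ G S.X₃
  prev (X : A) : G X → ∃ S, E S ∧ Nonempty (X ≅ S.X₃) ∧ G S.X₁

/-- The short exact sequences `0 ⟶ Z ⟶ P ⟶ Z' ⟶ 0` with `P` projective that remain exact under
`Hom(-, Q)` for all projective objects `Q`. -/
structure IsProjPiece (S : ShortComplex A) : Prop where
  shortExact : S.ShortExact
  projective : Projective S.X₂
  extend (Q : A) [Projective Q] (f : S.X₁ ⟶ Q) : ∃ g : S.X₂ ⟶ Q, S.f ≫ g = f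

/-- The short exact sequences `0 ⟶ Z ⟶ I ⟶ Z' ⟶ 0` with `I` injective that remain exact under
`Hom(J, -)` for all injective objects `J`. -/
structure IsInjPiece (S : ShortComplex A) : Prop where
  shortExact : S.ShortExact
  injective : Injective S.X₂
  lift (J : A) [Injective J] (f : J ⟶ S.X₃) : ∃ g : J ⟶ S.X₂, g ≫ S.g = f

lemma IsInjPiece.op {S : ShortComplex A} (h : IsInjPiece S) : IsProjPiece S.op where
  shortExact := h.shortExact.op
  projective := Injective.injective_iff_projective_op.1 h.injective
  extend Q _ f := by
    obtain ⟨g, hg⟩ := h.lift Q.unop f.unop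
    exact ⟨g.op, Quiver.Hom.unop_inj hg⟩

lemma IsProjPiece.unop {S : ShortComplex Aᵒᵖ} (h : IsProjPiece S) : IsInjPiece S.unop where
  shortExact := h.shortExact.unop
  injective := Injective.injective_iff_projective_op.2 h.projective
  lift J _ f := by
    obtain ⟨g, hg⟩ := h.extend (Opposite.op J) f.op
    exact ⟨g.unop, Quiver.Hom.op_inj hg⟩

lemma isSpliceable_op {G : A → Prop} (h : IsSpliceable IsInjPiece G) :
    IsSpliceable IsProjPiece fun X : Aᵒᵖ => G X.unop where
  next X hX := by
    obtain ⟨S, hS, ⟨e⟩, h'⟩ := h.prev _ hX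
    exact ⟨S.op, hS.op, ⟨e.symm.op⟩, h'⟩
  prev X hX := by
    obtain ⟨S, hS, ⟨e⟩, h'⟩ := h.next _ hX
    exact ⟨S.op, hS.op, ⟨e.symm.op⟩, h'⟩

lemma isSpliceable_unop {G : Aᵒᵖ → Prop} (h : IsSpliceable IsProjPiece G) :
    IsSpliceable IsInjPiece fun X : A => G (Opposite.op X) where
  next X hX := by
    obtain ⟨S, hS, ⟨e⟩, h'⟩ := h.prev _ hX
    exact ⟨S.unop, hS.unop, ⟨e.unop.symm⟩, h'⟩
  prev X hX := by
    obtain ⟨S, hS, ⟨e⟩, h'⟩ := h.next _ hX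
    exact ⟨S.unop, hS.unop, ⟨e.unop.symm⟩, h'⟩

/-- If all finitary dimensions are at most `k`, then the `k`-th syzygies form a spliceable class. -/
lemma isSpliceable_syzygies [EnoughProjectives A] [EnoughInjectives A]
    (H : ∀ X : A, HasFiniteProjDim X ↔ HasFiniteInjDim X) {k : ℕ} (hk : FinitaryProjDimLE A k) :
    IsSpliceable IsProjPiece fun Y : A => ∃ X, IsSyzygy k X Y := by
  let := HasExt.standard A
  have hext (X Y Q : A) [Projective Q] (h : IsSyzygy k X Y) : Subsingleton (Ext Y Q 1) := by
    have := (finitaryInjDimLE_iff H k).2 hk Q ((H Q).1 (.of_projective Q))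
    exact h.subsingleton_ext Q 0 (HasInjectiveDimensionLT.subsingleton Q (k + 1) _ (by lia) X)
  refine ⟨fun Y ⟨X, hX⟩ => ?_, fun Y ⟨X, hX⟩ => ?_⟩
  -- For `0 ⟶ X ⟶ I ⟶ X' ⟶ 0` with `I` injective, the `k`-th syzygy of `I` is projective, because
  -- `I` has projective dimension at most `k`.
  · obtain ⟨S, hS, h₂, rfl⟩ := exists_shortExact_injective X
    obtain ⟨R, hR, e, hR₂, hR₃⟩ := hX.exists_shortExact hS
    have : Projective R.X₂ := (projective_iff_hasProjectiveDimensionLE_zero _).2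
      ((hR₂.hasProjectiveDimensionLE_iff 0).1
        (by rw [zero_add]; exact hk _ ((H _).2 (.of_injective _))))
    exact ⟨R, ⟨hR, this, fun Q _ => exists_extend_of_subsingleton_ext_one hR (hext _ _ Q hR₃)⟩, e,
      _, hR₃⟩
  · obtain ⟨S, hS, h₂, rfl⟩ := exists_shortExact_projective Y
    obtain ⟨X', hX'⟩ := IsSyzygy.exists_of_succ (k := k) (X := X) (Y := S.X₁)
      ⟨S, hS, h₂, ⟨Iso.refl _⟩, hX⟩
    exact ⟨S, ⟨hS, h₂, fun Q _ => exists_extend_of_subsingleton_ext_one hS (hext _ _ Q hX)⟩,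
      ⟨Iso.refl _⟩, _, hX'⟩

/-- The objects of a class which is spliceable along sequences exact under `Hom(-, Q)` are
projective as soon as they have finite projective dimension. -/
lemma IsSpliceable.projective [EnoughProjectives A] {G : A → Prop}
    (hG : IsSpliceable IsProjPiece G) {X : A} (hX : G X) (h : HasFiniteProjDim X) :
    Projective X := by
  let := HasExt.standard A
  -- All objects of `G` are left orthogonal to the objects of finite projective dimension.
  have key (d : ℕ) : ∀ M : A, HasProjectiveDimensionLE M d → ∀ Y, G Y →
      Subsingleton (Ext Y M 1) := by
    induction d with
    | zero =>
      intro M hM Y hY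
      have := (projective_iff_hasProjectiveDimensionLE_zero _).2 hM
      obtain ⟨S, hS, ⟨e⟩, -⟩ := hG.prev Y hY
      have := hS.projective
      exact subsingleton_ext_of_iso_left e.symm M 1
        (subsingleton_ext_one_of_extend hS.shortExact (hS.extend M))
    | succ d ih =>
      intro M hM Y hY
      obtain ⟨S, hS, h₂, rfl⟩ := exists_shortExact_projective M
      obtain ⟨T, hT, ⟨e⟩, hT₁⟩ := hG.prev Y hY
      have := hT.projective
      refine subsingleton_ext_of_iso_left e.symm _ 1 (subsingleton_ext_right_X₃ hS ?_ ?_)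
      · exact subsingleton_ext_one_of_extend hT.shortExact (hT.extend S.X₂)
      · exact (subsingleton_ext_shift_left hT.shortExact S.X₁ 0).2
          (ih _ ((hS.hasProjectiveDimensionLT_X₃_iff d h₂).1 hM) _ hT₁)
  obtain ⟨S, hS, h₂, rfl⟩ := exists_shortExact_projective X
  obtain ⟨d, hd⟩ := h.of_shortExact hS
  exact projective_of_lift (exists_lift_of_subsingleton_ext_one hS (key d _ hd _ hX) (𝟙 _))

/-- In terms of spliceable classes, the global Gorenstein projective dimension is at most `k` if
and only if the finitary projective dimension is. -/
lemma forall_exists_spliceable_syzygy_iff [EnoughProjectives A] [EnoughInjectives A]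
    (H : ∀ X : A, HasFiniteProjDim X ↔ HasFiniteInjDim X) (k : ℕ) :
    (∀ X : A, ∃ j ≤ k, ∃ Y, IsSyzygy j X Y ∧ ∃ G, IsSpliceable IsProjPiece G ∧ G Y) ↔
      FinitaryProjDimLE A k := by
  refine ⟨fun h X hX => ?_, fun h X => ?_⟩
  · obtain ⟨j, hj, Y, hY, G, hG, hGY⟩ := h X
    have := hG.projective hGY (hY.hasFiniteProjDim hX)
    have := (hY.hasProjectiveDimensionLE_iff 0).2
      ((projective_iff_hasProjectiveDimensionLE_zero _).1 this)
    exact hasProjectiveDimensionLE_of_le this (by lia)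
  · obtain ⟨Y, hY⟩ := exists_isSyzygy k X
    exact ⟨k, le_rfl, Y, hY, _, isSpliceable_syzygies H h, X, hY⟩

lemma isSyzygy_op_iff (k : ℕ) (X Y : A) :
    IsSyzygy k (Opposite.op X) (Opposite.op Y) ↔ IsCosyzygy k X Y := by
  induction k generalizing Y with
  | zero => exact ⟨fun ⟨e⟩ => ⟨e.unop.symm⟩, fun ⟨e⟩ => ⟨e.symm.op⟩⟩
  | succ k ih =>
    constructor
    · rintro ⟨S, hS, h₂, ⟨e⟩, h⟩
      exact ⟨S.unop, hS.unop, Injective.injective_iff_projective_op.2 h₂, ⟨e.unop.symm⟩,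
        (ih _).1 h⟩
    · rintro ⟨S, hS, h₂, ⟨e⟩, h⟩
      exact ⟨S.op, hS.op, Injective.injective_iff_projective_op.1 h₂, ⟨e.symm.op⟩, (ih _).2 h⟩

end GorensteinProjective

/-! ### Splicing short exact sequences -/

section Splicing

variable {A : Type u} [Category.{v} A] [Abelian A]

/-- An object of a spliceable class fits into a sequence of matching short complexes, infinite in
both directions. -/
lemma IsSpliceable.exists_sequence {E : ShortComplex A → Prop} {G : A → Prop}
    (hG : IsSpliceable E G) {X : A} (hX : G X) :
    ∃ S : ℤ → ShortComplex A, (∀ i, E (S i)) ∧ (∀ i, Nonempty ((S i).X₃ ≅ (S (i + 1)).X₁)) ∧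
      Nonempty (X ≅ (S 0).X₁) := by
  choose! N hNE hNe hNG using hG.next
  choose! P hPE hPe hPG using hG.prev
  -- The outer terms, obtained by iterating both constructions starting from `X`.
  let z : ℕ → A := fun n => n.rec X fun _ Y => (N Y).X₃
  let y : ℕ → A := fun n => n.rec X fun _ Y => (P Y).X₁
  have hz (n : ℕ) : G (z n) := by
    induction n with
    | zero => exact hX
    | succ n ih => exact hNG _ ih
  have hy (n : ℕ) : G (y n) := by
    induction n with
    | zero => exact hX
    | succ n ih => exact hPG _ ih
  let S : ℤ → ShortComplex A
    | .ofNat n => N (z n)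
    | .negSucc n => P (y n)
  refine ⟨S, ?_, ?_, hNe _ hX⟩
  · rintro (n | n)
    exacts [hNE _ (hz n), hPE _ (hy n)]
  · rintro (n | n)
    · exact hNe _ (hz (n + 1))
    · cases n with
      | zero => exact ⟨(hPe _ hX).some.symm ≪≫ (hNe _ hX).some⟩
      | succ n => exact ⟨(hPe _ (hy (n + 1))).some.symm⟩

variable (S : ℤ → ShortComplex A) (hS : ∀ i, (S i).ShortExact)
  (e : ∀ i, (S i).X₃ ≅ (S (i + 1)).X₁)

/-- The complex obtained by splicing short exact sequences. -/
noncomputable def spliceComplex : CochainComplex A ℤ :=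
  CochainComplex.of (fun i => (S i).X₂) (fun i => (S i).g ≫ (e i).hom ≫ (S (i + 1)).f)
    (fun i => by simp)

lemma spliceComplex_d (i : ℤ) :
    (spliceComplex S e).d i (i + 1) = (S i).g ≫ (e i).hom ≫ (S (i + 1)).f :=
  CochainComplex.of_d (fun i => (S i).X₂) (fun i => (S i).g ≫ (e i).hom ≫ (S (i + 1)).f) i

include hS

lemma spliceComplex_acyclic : (spliceComplex S e).Acyclic := by
  intro j
  obtain ⟨i, rfl⟩ : ∃ i, j = i + 1 := ⟨j - 1, by ring⟩
  rw [HomologicalComplex.exactAt_iff' _ i (i + 1) (i + 1 + 1) (by simp) (by simp)]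
  have := (hS i).epi_g
  have := (hS (i + 1 + 1)).mono_f
  -- The exactness is that of `S (i + 1)`, up to composition with an epi and a mono.
  let φ₁ : ShortComplex.mk ((S i).g ≫ (e i).hom ≫ (S (i + 1)).f) (S (i + 1)).g (by simp) ⟶
      S (i + 1) :=
    { τ₁ := (S i).g ≫ (e i).hom, τ₂ := 𝟙 _, τ₃ := 𝟙 _ }
  let φ₂ : ShortComplex.mk ((S i).g ≫ (e i).hom ≫ (S (i + 1)).f) (S (i + 1)).g (by simp) ⟶
      (spliceComplex S e).sc' i (i + 1) (i + 1 + 1) :=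
    { τ₁ := 𝟙 _
      τ₂ := 𝟙 _
      τ₃ := (e (i + 1)).hom ≫ (S (i + 1 + 1)).f
      comm₁₂ := (Category.id_comp _).trans ((spliceComplex_d S e i).trans
        (Category.comp_id _).symm)
      comm₂₃ := (Category.id_comp _).trans (spliceComplex_d S e (i + 1)) }
  have : Epi φ₁.τ₁ := epi_comp _ _
  have : Mono φ₂.τ₃ := mono_comp (e (i + 1)).hom (S (i + 1 + 1)).f
  have : IsIso φ₁.τ₂ := inferInstanceAs (IsIso (𝟙 _))
  have : Mono φ₁.τ₃ := inferInstanceAs (Mono (𝟙 _))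
  have : IsIso φ₂.τ₂ := inferInstanceAs (IsIso (𝟙 _))
  have : Epi φ₂.τ₁ := inferInstanceAs (Epi (𝟙 _))
  exact (ShortComplex.exact_iff_of_epi_of_isIso_of_mono φ₂).1
    ((ShortComplex.exact_iff_of_epi_of_isIso_of_mono φ₁).2 (hS (i + 1)).exact)

lemma nonempty_iso_cycles_spliceComplex (i : ℤ) :
    Nonempty ((S i).X₁ ≅ (spliceComplex S e).cycles i) := by
  have := (hS (i + 1)).mono_f
  have hi := (hS i).mono_f
  have hker : IsLimit (KernelFork.ofι (f := (S i).g ≫ (e i).hom ≫ (S (i + 1)).f) (S i).f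
      (by simp)) :=
    KernelFork.IsLimit.ofι' (S i).f (by simp) fun {W} k hk => by
      have hk' : k ≫ (S i).g = 0 := by
        rw [← cancel_mono ((e i).hom ≫ (S (i + 1)).f), Category.assoc, hk, zero_comp]
      exact ⟨(hS i).exact.lift k hk', (hS i).exact.lift_f k hk'⟩
  have := (spliceComplex S e).cyclesIsKernel i (i + 1) (by simp)
  exact ⟨IsLimit.conePointsIsoOfNatIso hker this
    (parallelPair.ext (Iso.refl _) (Iso.refl _)
      ((Category.comp_id _).trans ((spliceComplex_d S e i).symm.trans (Category.id_comp _).symm))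
      (zero_comp.trans comp_zero.symm))⟩

end Splicing

section Cycles

variable {A : Type u} [Category.{v} A] [Abelian A] (K : CochainComplex A ℤ)

/-- The short complex `0 ⟶ Z^i ⟶ K^i ⟶ Z^{i+1} ⟶ 0`. -/
noncomputable def cyclesShortComplex (i : ℤ) : ShortComplex A :=
  ShortComplex.mk (K.iCycles i) (K.toCycles i (i + 1)) (by
    simp [← cancel_mono (K.iCycles (i + 1))])

variable {K}

lemma HomologicalComplex.Acyclic.shortExact_cyclesShortComplex (hK : K.Acyclic) (i : ℤ) :
    (cyclesShortComplex K i).ShortExact := by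
  refine ShortComplex.ShortExact.mk' ?_ (inferInstanceAs (Mono (K.iCycles i))) ?_
  · refine ShortComplex.exact_of_f_is_kernel _ (@KernelFork.IsLimit.ofι'
      _ _ _ _ _ _ _ (K.iCycles i) _ (fun {W} (k : W ⟶ K.X i) hk => ?_)
      (inferInstanceAs (Mono (K.iCycles i))))
    have hk' : k ≫ K.d i (i + 1) = 0 := by
      rw [← K.toCycles_i i (i + 1), ← Category.assoc]
      exact (congrArg (· ≫ K.iCycles (i + 1)) hk).trans zero_comp
    exact ⟨K.liftCycles k (i + 1) (by simp) hk', K.liftCycles_i _ _ _ _⟩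
  · exact Preadditive.epi_of_isZero_cokernel' _ (K.homologyIsCokernel i (i + 1) (by simp))
      (hK (i + 1)).isZero_homology

end Cycles

/-! ### Gorenstein projective and Gorenstein injective objects -/

section GorensteinObjects

variable {A : Type u} [Category.{v} A] [Abelian A]

/-- The extension property of complete projective resolutions, for arbitrary consecutive
indices. -/
lemma exists_extend_of_forall {K : CochainComplex A ℤ} {Q : A}
    (h : ∀ (i : ℤ) (f : K.X i ⟶ Q), K.d (i - 1) i ≫ f = 0 →
      ∃ g : K.X (i + 1) ⟶ Q, K.d i (i + 1) ≫ g = f)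
    {a b c : ℤ} (hab : a + 1 = b) (hbc : b + 1 = c) (f : K.X b ⟶ Q) (hf : K.d a b ≫ f = 0) :
    ∃ g : K.X c ⟶ Q, K.d b c ≫ g = f := by
  obtain rfl : a = b - 1 := by lia
  subst hbc
  exact h b f hf

lemma exists_lift_of_forall {K : CochainComplex A ℤ} {J : A}
    (h : ∀ (i : ℤ) (f : J ⟶ K.X i), f ≫ K.d i (i + 1) = 0 →
      ∃ g : J ⟶ K.X (i - 1), g ≫ K.d (i - 1) i = f)
    {a b c : ℤ} (hab : a + 1 = b) (hbc : b + 1 = c) (f : J ⟶ K.X b) (hf : f ≫ K.d b c = 0) :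
    ∃ g : J ⟶ K.X a, g ≫ K.d a b = f := by
  obtain rfl : a = b - 1 := by lia
  subst hbc
  exact h b f hf

/-- A Gorenstein projective object is an object of a spliceable class, namely that of all cycles
of a complete projective resolution. -/
lemma isGorensteinProjective_iff (X : A) :
    IsGorensteinProjective X ↔ ∃ G : A → Prop, IsSpliceable IsProjPiece G ∧ G X := by
  constructor
  · rintro ⟨K, hP, hK, hQ, e⟩
    have hpiece (i : ℤ) : IsProjPiece (cyclesShortComplex K i) := by
      refine ⟨hK.shortExact_cyclesShortComplex i, hP i, fun Q _ (f : K.cycles i ⟶ Q) => ?_⟩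
      obtain ⟨j, rfl⟩ : ∃ j, i = j + 1 := ⟨i - 1, by ring⟩
      have hd : K.d (j - 1) j ≫ K.toCycles j (j + 1) ≫ f = 0 := by simp
      obtain ⟨g, hg⟩ := exists_extend_of_forall (hQ Q) (by lia) rfl _ hd
      have := (hK.shortExact_cyclesShortComplex j).epi_g
      refine ⟨g, (cancel_epi (cyclesShortComplex K j).g).1 (Eq.trans ?_ hg)⟩
      exact (Category.assoc _ _ _).symm.trans (congrArg (· ≫ g) (K.toCycles_i j (j + 1)))
    refine ⟨fun Y => ∃ i, Nonempty (Y ≅ K.cycles i), ⟨?_, ?_⟩, 0, e⟩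
    · rintro Y ⟨i, e⟩
      exact ⟨_, hpiece i, e, i + 1, ⟨Iso.refl _⟩⟩
    · rintro Y ⟨i, e⟩
      obtain ⟨j, rfl⟩ : ∃ j, i = j + 1 := ⟨i - 1, by ring⟩
      exact ⟨_, hpiece j, e, j, ⟨Iso.refl _⟩⟩
  · rintro ⟨G, hG, hX⟩
    obtain ⟨S, hS, e, ⟨e₀⟩⟩ := hG.exists_sequence hX
    have hS' (i : ℤ) := (hS i).shortExact
    let e' (i : ℤ) := (e i).some
    have hext {Q : A} [Projective Q] (j : ℤ) (f : (S (j + 1)).X₂ ⟶ Q)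
        (hf : ((S j).g ≫ (e' j).hom ≫ (S (j + 1)).f) ≫ f = 0) :
        ∃ g, ((S (j + 1)).g ≫ (e' (j + 1)).hom ≫ (S (j + 1 + 1)).f) ≫ g = f := by
      have := (hS' j).epi_g
      have := (hS' (j + 1)).epi_g
      have hf' : (S (j + 1)).f ≫ f = 0 := by
        rw [← cancel_epi ((S j).g ≫ (e' j).hom), comp_zero]
        simpa using hf
      obtain ⟨t, ht⟩ := (hS (j + 1 + 1)).extend Q
        ((e' (j + 1)).inv ≫ (hS' (j + 1)).exact.desc f hf')
      exact ⟨t, by simp [ht]⟩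
    refine ⟨spliceComplex S e', fun i => (hS i).projective, spliceComplex_acyclic S hS' e',
      fun Q _ i f hf => ?_, ⟨e₀ ≪≫ (nonempty_iso_cycles_spliceComplex S hS' e' 0).some⟩⟩
    obtain ⟨j, rfl⟩ : ∃ j, i = j + 1 := ⟨i - 1, by ring⟩
    rw [add_sub_cancel_right, spliceComplex_d] at hf
    rw [spliceComplex_d]
    exact hext j f hf

lemma isGorensteinInjective_iff (X : A) :
    IsGorensteinInjective X ↔ ∃ G : A → Prop, IsSpliceable IsInjPiece G ∧ G X := by
  constructor
  · rintro ⟨K, hP, hK, hQ, e⟩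
    have hpiece (i : ℤ) : IsInjPiece (cyclesShortComplex K i) := by
      refine ⟨hK.shortExact_cyclesShortComplex i, hP i,
        fun J _ (f : J ⟶ K.cycles (i + 1)) => ?_⟩
      have hd : (f ≫ K.iCycles (i + 1)) ≫ K.d (i + 1) (i + 1 + 1) = 0 := by simp
      obtain ⟨g, hg⟩ := exists_lift_of_forall (hQ J) rfl rfl _ hd
      refine ⟨g, (cancel_mono (K.iCycles (i + 1))).1 (Eq.trans ?_ hg)⟩
      exact (Category.assoc _ _ _).trans (congrArg (g ≫ ·) (K.toCycles_i i (i + 1)))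
    refine ⟨fun Y => ∃ i, Nonempty (Y ≅ K.cycles i), ⟨?_, ?_⟩, 0, e⟩
    · rintro Y ⟨i, e⟩
      exact ⟨_, hpiece i, e, i + 1, ⟨Iso.refl _⟩⟩
    · rintro Y ⟨i, e⟩
      obtain ⟨j, rfl⟩ : ∃ j, i = j + 1 := ⟨i - 1, by ring⟩
      exact ⟨_, hpiece j, e, j, ⟨Iso.refl _⟩⟩
  · rintro ⟨G, hG, hX⟩
    obtain ⟨S, hS, e, ⟨e₀⟩⟩ := hG.exists_sequence hX
    have hS' (i : ℤ) := (hS i).shortExact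
    let e' (i : ℤ) := (e i).some
    have hlift {J : A} [Injective J] (j : ℤ) (f : J ⟶ (S (j + 1)).X₂)
        (hf : f ≫ ((S (j + 1)).g ≫ (e' (j + 1)).hom ≫ (S (j + 1 + 1)).f) = 0) :
        ∃ g, g ≫ ((S j).g ≫ (e' j).hom ≫ (S (j + 1)).f) = f := by
      have := (hS' (j + 1)).mono_f
      have := (hS' (j + 1 + 1)).mono_f
      have hf' : f ≫ (S (j + 1)).g = 0 := by
        rw [← cancel_mono ((e' (j + 1)).hom ≫ (S (j + 1 + 1)).f), zero_comp]
        simpa using hf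
      obtain ⟨t, ht⟩ := (hS j).lift J ((hS' (j + 1)).exact.lift f hf' ≫ (e' j).inv)
      exact ⟨t, by rw [reassoc_of% ht]; simp⟩
    refine ⟨spliceComplex S e', fun i => (hS i).injective, spliceComplex_acyclic S hS' e',
      fun J _ i f hf => ?_, ⟨e₀ ≪≫ (nonempty_iso_cycles_spliceComplex S hS' e' 0).some⟩⟩
    obtain ⟨j, rfl⟩ : ∃ j, i = j + 1 := ⟨i - 1, by ring⟩
    have := hlift j f (by rw [← spliceComplex_d]; exact hf)
    rwa [add_sub_cancel_right, spliceComplex_d]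

end GorensteinObjects

/-! ### Gorenstein dimension -/

section GorensteinDimension

variable {A : Type u} [Category.{v} A] [Abelian A] [EnoughProjectives A] [EnoughInjectives A]
  (H : ∀ X : A, HasFiniteProjDim X ↔ HasFiniteInjDim X)

include H

lemma forall_hasGorensteinProjDimLE_iff (k : ℕ) :
    (∀ X : A, HasGorensteinProjDimLE X k) ↔ FinitaryProjDimLE A k := by
  rw [← forall_exists_spliceable_syzygy_iff H]
  simp only [HasGorensteinProjDimLE, isGorensteinProjective_iff]

/-- The injective case is the projective one in the opposite category, whose finitary projective
dimension is that of the original category by `finitaryInjDimLE_iff`. -/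
lemma forall_hasGorensteinInjDimLE_iff (k : ℕ) :
    (∀ X : A, HasGorensteinInjDimLE X k) ↔ FinitaryProjDimLE A k := by
  have H' (X : Aᵒᵖ) : HasFiniteProjDim X ↔ HasFiniteInjDim X :=
    (hasFiniteProjDim_op_iff X.unop).trans ((H _).symm.trans (hasFiniteInjDim_op_iff X.unop).symm)
  rw [← finitaryInjDimLE_iff H, ← finitaryProjDimLE_op_iff,
    ← forall_exists_spliceable_syzygy_iff H']
  simp only [HasGorensteinInjDimLE, isGorensteinInjective_iff]
  constructor
  · intro h X
    obtain ⟨j, hj, Y, hY, G, hG, hGY⟩ := h X.unop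
    exact ⟨j, hj, Opposite.op Y, (isSyzygy_op_iff _ _ _).2 hY, _, isSpliceable_op hG, hGY⟩
  · intro h X
    obtain ⟨j, hj, Y, hY, G, hG, hGY⟩ := h (Opposite.op X)
    exact ⟨j, hj, Y.unop, (isSyzygy_op_iff _ _ _).1 hY, _, isSpliceable_unop hG, hGY⟩

/-- A Grothendieck category with enough projectives in which finite projective and finite
injective dimension agree, the former being bounded by `n`, is Gorenstein of some dimension
`m ≤ n`. -/
lemma exists_isGorensteinOfDim [IsGrothendieckAbelian.{w} A] {n : ℕ}
    (hn : FinitaryProjDimLE A n) {G : A} (hG : IsSeparator G) [Projective G] :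
    ∃ m ≤ n, IsGorensteinOfDim.{w} A m := by
  classical
  have hex : ∃ k, FinitaryProjDimLE A k := ⟨n, hn⟩
  have hleast : IsLeast {k | FinitaryProjDimLE A k} (Nat.find hex) :=
    ⟨Nat.find_spec hex, fun k hk => Nat.find_min' hex hk⟩
  refine ⟨Nat.find hex, Nat.find_min' hex hn, ⟨inferInstance, H, hex, ?_, G, hG, .of_projective G⟩,
    hleast, ?_, ?_, ?_⟩
  · simpa only [finitaryInjDimLE_iff H] using hex
  · simpa only [finitaryInjDimLE_iff H] using hleast
  · simpa only [forall_hasGorensteinProjDimLE_iff H] using hleast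
  · simpa only [forall_hasGorensteinInjDimLE_iff H] using hleast

end GorensteinDimension

/-! ### Eklof's lemma and extensions by quotients of a projective object -/

section Lifting

open Abelian

variable {A : Type u} [Category.{v} A] [Abelian A]

/-- The cokernel sequence of a composition `f ≫ g` with `g` mono. -/
lemma shortExact_cokernel_comp {X Y Z : A} (f : X ⟶ Y) (g : Y ⟶ Z) [Mono g] :
    (ShortComplex.mk (cokernel.map f (f ≫ g) (𝟙 _) g (by simp))
      (cokernel.map (f ≫ g) g f (𝟙 _) (by simp))
      (by simp [← cancel_epi (cokernel.π f)])).ShortExact := by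
  have he : Epi (cokernel.map (f ≫ g) g f (𝟙 _) (by simp)) := by
    refine @epi_of_epi _ _ _ _ _ (cokernel.π (f ≫ g)) _ ?_
    rw [cokernel.π_desc, Category.id_comp]
    infer_instance
  have hm : Mono (kernelCokernelCompSequence.snakeInput f g).L₃.f := by
    refine (kernelCokernelCompSequence.snakeInput f g).L₂'_exact.mono_g ?_
    exact (isZero_kernel_of_mono g).eq_of_src _ _
  exact ShortComplex.ShortExact.mk' (kernelCokernelCompSequence.snakeInput f g).L₃_exact hm he

/-- A monomorphism whose cokernel `Q` satisfies `Ext¹(Q, F) = 0` has the left lifting property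
with respect to the cokernel of an embedding of `F` into an injective object. -/
lemma hasLiftingProperty_of_subsingleton_ext_one [HasExt.{w} A] {S T : ShortComplex A}
    (hS : S.ShortExact) (hT : T.ShortExact) [Injective T.X₂]
    (h : Subsingleton (Ext S.X₃ T.X₁ 1)) : HasLiftingProperty S.f T.g where
  sq_hasLift {a b} sq := by
    have := hS.mono_f
    have := hS.epi_g
    let a' := Injective.factorThru a S.f
    have ha' : S.f ≫ a' = a := Injective.comp_factorThru _ _
    obtain ⟨c, hc⟩ := exists_lift_of_subsingleton_ext_one hT h
      (hS.exact.desc (b - a' ≫ T.g) (by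
        rw [Preadditive.comp_sub, reassoc_of% ha', sq.w, sub_self]))
    exact ⟨⟨⟨a' + S.g ≫ c, by simp [ha'], by simp [hc]⟩⟩⟩

end Lifting

section Eklof

open Abelian

universe w'

variable {A : Type u} [Category.{v} A] [Abelian A] [IsGrothendieckAbelian.{w} A]
  {X : A} {J : Type w} [LinearOrder J] [OrderBot J] [SuccOrder J] [WellFoundedLT J]
  (K : J → Subobject X) (hK : Monotone K)

/-- The functor to `A` corresponding to an increasing family of subobjects. -/
noncomputable def chainFunctor : J ⥤ MonoOver X where
  obj j := MonoOver.mk (K j).arrow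
  map f := MonoOver.homMk (Subobject.ofLE _ _ (hK (leOfHom f)))

omit [OrderBot J] [SuccOrder J] [WellFoundedLT J] in
lemma isWellOrderContinuous_chainFunctor
    (hlim : ∀ m, Order.IsSuccLimit m → K m = ⨆ i : Set.Iio m, K i) :
    ((chainFunctor K hK ⋙ MonoOver.forget X) ⋙ Over.forget X).IsWellOrderContinuous where
  nonempty_isColimit m hm := ⟨by
    have := hm.nonempty_Iio.to_subtype
    let c := (Set.principalSegIio m).cocone (chainFunctor K hK ⋙ MonoOver.forget _)
    have : Mono c.pt.hom := inferInstanceAs (Mono (K m).arrow)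
    apply IsGrothendieckAbelian.isColimitMapCoconeOfSubobjectMkEqISup
      ((Set.principalSegIio m).monotone.functor ⋙ chainFunctor K hK) c
    refine (Subobject.mk_arrow (K m)).trans ((hlim m hm).trans ?_)
    exact iSup_congr fun j => (Subobject.mk_arrow (K j)).symm⟩

/-- **Eklof's lemma** for an increasing continuous chain of subobjects, in all positive degrees:
the vanishing of extensions passes from the successive quotients of the chain to its union. -/
lemma subsingleton_ext_iSup_of_chain [HasExt.{w'} A] (hbot : K ⊥ = ⊥)
    (hlim : ∀ m, Order.IsSuccLimit m → K m = ⨆ i : Set.Iio m, K i) (i : ℕ) (F : A)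
    (hsucc : ∀ j, Subsingleton (Ext (cokernel (Subobject.ofLE _ _ (hK (Order.le_succ j)))) F
      (i + 1))) :
    Subsingleton (Ext ((⨆ j, K j : Subobject X) : A) F (i + 1)) := by
  induction i generalizing F with
  | succ i ih =>
    obtain ⟨T, hT, h₂, rfl⟩ := exists_shortExact_injective F
    rw [subsingleton_ext_shift_right hT]
    exact ih _ fun j => (subsingleton_ext_shift_right hT _ _).1 (hsucc j)
  | zero =>
    obtain ⟨T, hT, h₂, rfl⟩ := exists_shortExact_injective F
    have := isWellOrderContinuous_chainFunctor K hK hlim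
    let c : Cocone (chainFunctor K hK ⋙ MonoOver.forget _) :=
      { pt := Over.mk (⨆ j, K j : Subobject X).arrow
        ι :=
          { app j := Over.homMk (Subobject.ofLE _ _ (le_iSup K j)) (Subobject.ofLE_arrow _)
            naturality j j' f := by
              ext
              exact (Subobject.ofLE_comp_ofLE _ _ _ _ _).trans (Category.comp_id _).symm } }
    have : Mono c.pt.hom := inferInstanceAs (Mono (⨆ j, K j : Subobject X).arrow)
    have hc := IsGrothendieckAbelian.isColimitMapCoconeOfSubobjectMkEqISup
      (chainFunctor K hK) c ((Subobject.mk_arrow _).trans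
        (iSup_congr fun j => (Subobject.mk_arrow (K j)).symm))
    have hl : HasLiftingProperty (((Over.forget _).mapCocone c).ι.app ⊥) T.g :=
      HasLiftingProperty.transfiniteComposition.hasLiftingProperty_ι_app_bot hc fun j hj => by
        let S : ShortComplex A :=
          ShortComplex.mk _ _ (cokernel.condition (Subobject.ofLE _ _ (hK (Order.le_succ j))))
        have hS : S.ShortExact :=
          { exact := ShortComplex.exact_of_g_is_cokernel _ (cokernelIsCokernel _) }
        exact hasLiftingProperty_of_subsingleton_ext_one hS hT (hsucc j)
    refine subsingleton_ext_one_of_lift hT fun f => ?_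
    have hz : IsZero ((K ⊥ : Subobject X) : A) := by
      rw [hbot]
      exact (isZero_zero A).of_iso Subobject.botCoeIsoZero
    have sq : CommSq 0 (((Over.forget _).mapCocone c).ι.app ⊥) T.g f := ⟨hz.eq_of_src _ _⟩
    have := hl.sq_hasLift sq
    exact ⟨sq.lift, sq.fac_right⟩

/-- Let `G` be projective, and let `L` be a family of subobjects of `G`. If `F` has no higher
extensions by the quotients of `G` by sums of finitely many members of `L`, then it has
no extensions of degree `> d` by the quotients of `G` by sums of less than `ℵ_d` members. -/
lemma subsingleton_ext_cokernel_iSup_of_lt_aleph [HasExt.{w'} A] {G : A} [Projective G]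
    {I : Type w} (L : I → Subobject G) (F : A)
    (hfin : ∀ (s : Set I), s.Finite → ∀ j, Subsingleton
      (Ext (cokernel (⨆ i ∈ s, L i : Subobject G).arrow) F (j + 1))) (d : ℕ) (s : Set I)
    (hs : Cardinal.mk s < Cardinal.aleph d) (j : ℕ) :
    Subsingleton (Ext (cokernel (⨆ i ∈ s, L i : Subobject G).arrow) F (j + d + 1)) := by
  induction d generalizing s j with
  | zero => exact hfin s (Cardinal.lt_aleph0_iff_set_finite.1 (by simpa using hs)) j
  | succ d ih =>
    rcases s.eq_empty_or_nonempty with rfl | hne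
    · exact hfin ∅ Set.finite_empty _
    -- Enumerate `s` along the initial ordinal of `ℵ_d`: its proper initial segments have fewer than
    -- `ℵ_d` elements, so the induction hypothesis applies to the steps of the resulting chain.
    have hs' : Cardinal.mk s ≤ Cardinal.aleph d := by
      rw [Nat.cast_succ, ← Cardinal.succ_aleph] at hs
      exact Order.lt_succ_iff.1 hs
    let J := (Cardinal.aleph.{w} d).ord.ToType
    have : Nonempty J := by
      rw [← Cardinal.mk_ne_zero_iff, Cardinal.mk_ord_toType]
      exact (Cardinal.aleph_pos _).ne'
    have := WellFoundedLT.toOrderBot J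
    have := SuccOrder.ofLinearWellFoundedLT J
    have : NoMaxOrder J := Cardinal.noMaxOrder (Cardinal.aleph0_le_aleph _)
    have hJ : Cardinal.mk J = Cardinal.aleph d := by simp [J]
    have := hne.to_subtype
    obtain ⟨g, hg⟩ : ∃ g : J → s, Function.Surjective g := by
      obtain ⟨f⟩ : Nonempty (s ↪ J) := hs'.trans_eq hJ.symm
      exact ⟨_, Function.invFun_surjective f.injective⟩
    let K : J → Subobject G := fun a => ⨆ i ∈ (fun b => (g b : I)) '' Set.Iio a, L i
    have hKL (a : J) : L (g a) ≤ K (Order.succ a) :=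
      le_iSup₂_of_le (g a) ⟨a, Order.lt_succ a, rfl⟩ le_rfl
    have hK : Monotone K := fun a b hab =>
      biSup_mono fun i hi => Set.image_mono (Set.Iio_subset_Iio hab) hi
    have hKsup : ⨆ a, K a = ⨆ i ∈ s, L i := by
      apply le_antisymm
      · refine iSup_le fun a => iSup₂_le ?_
        rintro _ ⟨b, -, rfl⟩
        exact le_iSup₂_of_le _ (g b).2 le_rfl
      · refine iSup₂_le fun i hi => ?_
        obtain ⟨a, ha⟩ := hg ⟨i, hi⟩
        have := hKL a
        rw [ha] at this
        exact this.trans (le_iSup K _)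
    have hKext (a : J) (j : ℕ) : Subsingleton (Ext (cokernel (K a).arrow) F (j + d + 1)) := by
      refine ih _ (Cardinal.mk_image_le.trans_lt ?_) j
      exact (Cardinal.mk_Iio_lt a (by simp [J])).trans_eq hJ
    have key : Subsingleton (Ext ((⨆ a, K a : Subobject G) : A) F (j + d + 1)) := by
      refine subsingleton_ext_iSup_of_chain K hK ?_ ?_ _ F fun a => ?_
      · simp [K]
      · intro m hm
        apply le_antisymm
        · refine iSup₂_le ?_
          rintro _ ⟨b, hb, rfl⟩
          exact (hKL b).trans
            (le_iSup (fun i : Set.Iio m => K i) ⟨_, hm.succ_lt hb⟩)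
        · exact iSup_le fun i => hK i.2.le
      · have hS := shortExact_cokernel_comp (Subobject.ofLE _ _ (hK (Order.le_succ a)))
          (K (Order.succ a)).arrow
        refine subsingleton_ext_X₁ hS ?_ ?_
        · refine subsingleton_ext_of_iso_left (cokernelIsoOfEq (Subobject.ofLE_arrow _).symm) _ _
            (hKext a j)
        · have := hKext (Order.succ a) (j + 1)
          rwa [show j + 1 + d + 1 = j + d + 1 + 1 by ring] at this
    let S : ShortComplex A := ShortComplex.mk _ _ (cokernel.condition (⨆ i ∈ s, L i).arrow)
    have hS : S.ShortExact :=
      { exact := ShortComplex.exact_of_g_is_cokernel _ (cokernelIsCokernel _) }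
    have : Projective S.X₂ := inferInstanceAs (Projective G)
    rw [hKsup] at key
    exact (subsingleton_ext_shift_left hS F (j + d)).2 key

end Eklof

/-! ### Baer's criterion for the injective dimension -/

section Baer

universe w'

open Abelian

/-- Baer's criterion for the injective dimension: in a Grothendieck category it suffices to test
on the quotients of a generator. -/
lemma hasInjectiveDimensionLE_of_subsingleton_ext_cokernel {A : Type u} [Category.{v} A]
    [Abelian A] [IsGrothendieckAbelian.{w} A] [HasExt.{w'} A] {G : A} (hG : IsSeparator G) (d : ℕ)
    (F : A) (h : ∀ K : Subobject G, Subsingleton (Ext (cokernel K.arrow) F (d + 1))) :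
    HasInjectiveDimensionLE F d := by
  have := IsGrothendieckAbelian.enoughInjectives (C := A)
  induction d generalizing F with
  | zero =>
    refine injective_iff_hasInjectiveDimensionLT_one.1 ⟨fun {X Y} g f _ => ?_⟩
    -- Injectivity of `F` is the right lifting property of `F ⟶ 0` for monomorphisms.
    have hr : (IsGrothendieckAbelian.generatingMonomorphisms G).rlp (0 : F ⟶ 0) := by
      rintro _ _ _ ⟨K⟩
      refine ⟨fun {a b} sq => ?_⟩
      have hS : (ShortComplex.mk _ _ (cokernel.condition K.arrow)).ShortExact :=
        { exact := ShortComplex.exact_of_g_is_cokernel _ (cokernelIsCokernel _) }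
      obtain ⟨e, he⟩ := exists_extend_of_subsingleton_ext_one hS (h K) a
      exact ⟨⟨⟨e, he, (isZero_zero A).eq_of_tgt _ _⟩⟩⟩
    rw [IsGrothendieckAbelian.generatingMonomorphisms_rlp hG] at hr
    have := hr f (by simpa)
    have sq : CommSq g f (0 : F ⟶ 0) 0 := ⟨(isZero_zero A).eq_of_tgt _ _⟩
    exact ⟨sq.lift, sq.fac_left⟩
  | succ d ih =>
    obtain ⟨S, hS, _, rfl⟩ := exists_shortExact_injective F
    refine (hS.hasInjectiveDimensionLT_X₃_iff d inferInstance).1 (ih _ fun K => ?_)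
    exact (subsingleton_ext_shift_right hS _ d).1 (h K)

/-- Let `G` be a projective generator of a Grothendieck category each of whose subobjects is a sum
of members of a family `L` with at most `ℵ_n` members. If `F` has no higher extensions by the
quotients of `G` by sums of finitely many members of `L`, then its injective dimension is at most
`n + 1`. -/
lemma hasInjectiveDimensionLE_of_isLUB {A : Type u} [Category.{v} A]
    [Abelian A] [IsGrothendieckAbelian.{w} A] [HasExt.{w'} A] {G : A} [Projective G]
    (hG : IsSeparator G) {I : Type w} (L : I → Subobject G) {n : ℕ}
    (hI : Cardinal.mk I ≤ Cardinal.aleph n) (F : A)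
    (hgen : ∀ K : Subobject G, ∃ s : Set I, IsLUB (L '' s) K)
    (hfin : ∀ s : Set I, s.Finite → ∃ K : Subobject G, IsLUB (L '' s) K ∧
      ∀ j, Subsingleton (Ext (cokernel K.arrow) F (j + 1))) :
    HasInjectiveDimensionLE F (n + 1) := by
  refine hasInjectiveDimensionLE_of_subsingleton_ext_cokernel hG (n + 1) F fun K => ?_
  have hsup (s : Set I) (K : Subobject G) (h : IsLUB (L '' s) K) : ⨆ i ∈ s, L i = K := by
    rw [← sSup_image]
    exact h.sSup_eq
  obtain ⟨s, hs⟩ := hgen K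
  have := subsingleton_ext_cokernel_iSup_of_lt_aleph L F (fun t ht j => by
    obtain ⟨K', hK', hj⟩ := hfin t ht
    rw [hsup t K' hK']
    exact hj j) (n + 1) s ((Cardinal.mk_set_le s).trans_lt (hI.trans_lt (by simp))) 0
  rw [hsup s K hs] at this
  rwa [zero_add] at this

end Baer

/-! ### The category of right modules is AB5, and its exactness is pointwise -/

section ModuleCategory

variable {C : Type u} [Category.{v} C] [Preadditive C]

instance additiveFunctor_isClosedUnderColimitsOfShape (J : Type*) [Category* J]
    [HasColimitsOfShape J AddCommGrpCat.{v}] :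
    (additiveFunctor Cᵒᵖ AddCommGrpCat.{v}).IsClosedUnderColimitsOfShape J := ⟨by
  rintro F ⟨p⟩
  refine ⟨fun {X Y f g} => ?_⟩
  refine (isColimitOfPreserves ((evaluation Cᵒᵖ AddCommGrpCat.{v}).obj X) p.isColimit).hom_ext
    fun j => ?_
  have : (p.diag.obj j).Additive := p.prop_diag_obj j
  change (p.ι.app j).app X ≫ F.map (f + g) = (p.ι.app j).app X ≫ (F.map f + F.map g)
  rw [Preadditive.comp_add]
  erw [← NatTrans.naturality, ← NatTrans.naturality, ← NatTrans.naturality]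
  rw [← Preadditive.add_comp]
  congr 1
  exact Functor.map_add _⟩

instance additiveFunctor_isClosedUnderLimitsOfShape (J : Type*) [Category* J]
    [HasLimitsOfShape J AddCommGrpCat.{v}] :
    (additiveFunctor Cᵒᵖ AddCommGrpCat.{v}).IsClosedUnderLimitsOfShape J := ⟨by
  rintro F ⟨p⟩
  refine ⟨fun {X Y f g} => ?_⟩
  refine (isLimitOfPreserves ((evaluation Cᵒᵖ AddCommGrpCat.{v}).obj Y) p.isLimit).hom_ext
    fun j => ?_
  have : (p.diag.obj j).Additive := p.prop_diag_obj j
  change F.map (f + g) ≫ (p.π.app j).app Y = (F.map f + F.map g) ≫ (p.π.app j).app Y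
  rw [NatTrans.naturality, Preadditive.add_comp, NatTrans.naturality, NatTrans.naturality,
    ← Preadditive.comp_add]
  congr 1
  exact Functor.map_add _⟩

instance : HasColimitsOfSize.{v, v} (RightMod C) := ⟨fun _ _ => inferInstance⟩

instance : HasFilteredColimitsOfSize.{v, v} (RightMod C) :=
  hasFilteredColimitsOfSize_of_hasColimitsOfSize

instance : PreservesFiniteLimits (additiveFunctor Cᵒᵖ AddCommGrpCat.{v}).ι :=
  ⟨fun _ _ _ => ⟨inferInstance⟩⟩
instance : PreservesFiniteColimits (additiveFunctor Cᵒᵖ AddCommGrpCat.{v}).ι :=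
  ⟨fun _ _ _ => inferInstance⟩

instance : AB5OfSize.{v, v} (RightMod C) := ⟨fun J _ _ =>
   HasExactColimitsOfShape.domain_of_functor J (additiveFunctor Cᵒᵖ AddCommGrpCat.{v}).ι⟩

variable (C) in
/-- The evaluation functor `M ↦ M(c)` on right modules. -/
abbrev RightMod.eval (c : C) : RightMod C ⥤ AddCommGrpCat.{v} :=
  (additiveFunctor Cᵒᵖ AddCommGrpCat.{v}).ι ⋙ (evaluation _ _).obj (Opposite.op c)

lemma RightMod.exact_iff_eval (S : ShortComplex (RightMod C)) :
    S.Exact ↔ ∀ c, (S.map (RightMod.eval C c)).Exact := by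
  refine ⟨fun h c => h.map _, fun h => ?_⟩
  rw [← ShortComplex.exact_map_iff_of_faithful S (additiveFunctor Cᵒᵖ AddCommGrpCat.{v}).ι,
    ShortComplex.exact_iff_isZero_homology]
  refine Functor.isZero _ fun c => ?_
  have h' := (ShortComplex.exact_iff_isZero_homology _).1 (h c.unop)
  exact h'.of_iso (ShortComplex.mapHomologyIso (S.map (additiveFunctor Cᵒᵖ AddCommGrpCat.{v}).ι)
    ((evaluation _ _).obj c)).symm

lemma RightMod.exact_iff (S : ShortComplex (RightMod C)) :
    S.Exact ↔ ∀ (c : C) (x : S.X₂.obj.obj (Opposite.op c)), S.g.hom.app _ x = 0 →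
      ∃ y : S.X₁.obj.obj (Opposite.op c), S.f.hom.app _ y = x := by
  rw [RightMod.exact_iff_eval]
  exact forall_congr' fun c => ShortComplex.ab_exact_iff _

lemma RightMod.mono_iff {M N : RightMod C} (φ : M ⟶ N) :
    Mono φ ↔ ∀ c : C, Function.Injective (φ.hom.app (Opposite.op c)) := by
  constructor
  · intro h c
    exact (AddCommGrpCat.mono_iff_injective _).1
      (inferInstanceAs (Mono ((RightMod.eval C c).map φ)))
  · intro h
    have (c : Cᵒᵖ) : Mono (φ.hom.app c) := (AddCommGrpCat.mono_iff_injective _).2 (h c.unop)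
    have := NatTrans.mono_of_mono_app φ.hom
    exact (additiveFunctor Cᵒᵖ AddCommGrpCat.{v}).ι.mono_of_mono_map this

lemma RightMod.epi_iff {M N : RightMod C} (φ : M ⟶ N) :
    Epi φ ↔ ∀ c : C, Function.Surjective (φ.hom.app (Opposite.op c)) := by
  constructor
  · intro h c
    exact (AddCommGrpCat.epi_iff_surjective _).1
      (inferInstanceAs (Epi ((RightMod.eval C c).map φ)))
  · intro h
    have (c : Cᵒᵖ) : Epi (φ.hom.app c) := (AddCommGrpCat.epi_iff_surjective _).2 (h c.unop)
    have := NatTrans.epi_of_epi_app φ.hom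
    exact (additiveFunctor Cᵒᵖ AddCommGrpCat.{v}).ι.epi_of_epi_map this

end ModuleCategory

/-! ### Representable and free modules -/

section FreeModules

variable {C : Type u} [Category.{v} C] [Preadditive C]

open Opposite

namespace RightMod

lemma hom_ext {M N : RightMod C} {φ ψ : M ⟶ N}
    (h : ∀ (c : C) (x : M.obj.obj (op c)), φ.hom.app _ x = ψ.hom.app _ x) : φ = ψ := by
  ext c x
  exact h c.unop x

lemma map_comp_apply (M : RightMod C) {a b c : C} (f : a ⟶ b) (g : b ⟶ c)
    (x : M.obj.obj (op c)) : M.obj.map (f ≫ g).op x = M.obj.map f.op (M.obj.map g.op x) := by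
  rw [op_comp, M.obj.map_comp]; rfl

lemma map_id_apply (M : RightMod C) {a : C} (x : M.obj.obj (op a)) :
    M.obj.map (𝟙 a).op x = x := by
  rw [op_id, M.obj.map_id]; rfl

lemma map_add_apply (M : RightMod C) {a b : C} (f g : a ⟶ b) (x : M.obj.obj (op b)) :
    M.obj.map (f + g).op x = M.obj.map f.op x + M.obj.map g.op x := by
  rw [op_add, M.obj.map_add]; rfl

lemma map_sub_apply (M : RightMod C) {a b : C} (f g : a ⟶ b) (x : M.obj.obj (op b)) :
    M.obj.map (f - g).op x = M.obj.map f.op x - M.obj.map g.op x := by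
  rw [op_sub, M.obj.map_sub]; rfl

lemma map_zero_apply (M : RightMod C) {a b : C} (x : M.obj.obj (op b)) :
    M.obj.map (0 : a ⟶ b).op x = 0 := by
  rw [op_zero, M.obj.map_zero]; rfl

lemma naturality {M N : RightMod C} (φ : M ⟶ N) {a b : C} (f : a ⟶ b) (x : M.obj.obj (op b)) :
    φ.hom.app _ (M.obj.map f.op x) = N.obj.map f.op (φ.hom.app _ x) :=
  NatTrans.naturality_apply φ.hom f.op x

lemma comp_apply_eq_zero (S : ShortComplex (RightMod C)) {c : C} (x : S.X₁.obj.obj (op c)) :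
    S.g.hom.app _ (S.f.hom.app _ x) = 0 :=
  congrArg (fun φ : S.X₁ ⟶ S.X₃ => φ.hom.app _ x) S.zero

lemma injective_of_shortExact {S : ShortComplex (RightMod C)} (hS : S.ShortExact) (c : C) :
    Function.Injective (S.f.hom.app (op c)) :=
  (mono_iff S.f).1 hS.mono_f c

lemma surjective_of_shortExact {S : ShortComplex (RightMod C)} (hS : S.ShortExact) (c : C) :
    Function.Surjective (S.g.hom.app (op c)) :=
  (epi_iff S.g).1 hS.epi_g c

/-- The representable module `Hom(-, a)`. -/
abbrev rep (a : C) : RightMod C := AdditiveFunctor.of (preadditiveYoneda.obj a)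

/-- The Yoneda correspondence: the morphism `Hom(-, a) ⟶ M` given by an element of `M(a)`. -/
def repHom {M : RightMod C} {a : C} (m : M.obj.obj (op a)) : rep a ⟶ M :=
  ObjectProperty.homMk
    { app c := AddCommGrpCat.ofHom
        { toFun g := M.obj.map (Quiver.Hom.op (show c.unop ⟶ a from g)) m
          map_zero' := M.map_zero_apply m
          map_add' g g' := M.map_add_apply (show c.unop ⟶ a from g) g' m }
      naturality c d f := by
        ext g
        exact M.map_comp_apply f.unop (show c.unop ⟶ a from g) m }

/-- The identity of `a`, as an element of `Hom(-, a)`. -/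
def repOne (a : C) : (rep a).obj.obj (op a) := 𝟙 a

lemma repHom_apply_one {M : RightMod C} {a : C} (m : M.obj.obj (op a)) :
    (repHom m).hom.app (op a) (repOne a) = m := M.map_id_apply m

lemma rep_map_repOne {a b : C} (f : a ⟶ b) : (rep b).obj.map f.op (repOne b) = f :=
  Category.comp_id f

lemma rep_hom_ext {M : RightMod C} {a : C} {φ ψ : rep a ⟶ M}
    (h : φ.hom.app (op a) (repOne a) = ψ.hom.app (op a) (repOne a)) : φ = ψ := by
  refine hom_ext fun c (g : c ⟶ a) => ?_
  have h₁ := naturality φ g (repOne a)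
  have h₂ := naturality ψ g (repOne a)
  rw [rep_map_repOne] at h₁ h₂
  rw [h₁, h₂, h]

lemma repHom_comp {M N : RightMod C} {a : C} (m : M.obj.obj (op a)) (φ : M ⟶ N) :
    repHom m ≫ φ = repHom (φ.hom.app _ m) :=
  rep_hom_ext (by
    rw [repHom_apply_one]
    exact congrArg (φ.hom.app _) (repHom_apply_one m))

lemma exists_eq_repHom {M : RightMod C} {a : C} (φ : rep a ⟶ M) : ∃ m, φ = repHom m :=
  ⟨φ.hom.app _ (repOne a), rep_hom_ext (repHom_apply_one _).symm⟩

lemma repHom_injective {M : RightMod C} {a : C} {m m' : M.obj.obj (op a)}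
    (h : repHom m = repHom m') : m = m' := by
  rw [← repHom_apply_one m, h, repHom_apply_one]

lemma repHom_add {M : RightMod C} {a : C} (m m' : M.obj.obj (op a)) :
    repHom (m + m') = repHom m + repHom m' :=
  rep_hom_ext (by
    rw [repHom_apply_one]
    exact (congrArg₂ (· + ·) (repHom_apply_one m) (repHom_apply_one m')).symm)

lemma repHom_zero {M : RightMod C} {a : C} : repHom (0 : M.obj.obj (op a)) = 0 :=
  rep_hom_ext (repHom_apply_one _)

/-- The morphism between representable modules induced by a morphism. -/
def repMap {a b : C} (u : a ⟶ b) : rep a ⟶ rep b := repHom (M := rep b) u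

lemma repMap_comp_repHom {M : RightMod C} {a b : C} (u : a ⟶ b) (m : M.obj.obj (op b)) :
    repMap u ≫ repHom m = repHom (M.obj.map u.op m) :=
  repHom_comp _ _

lemma repMap_comp {a b c : C} (u : a ⟶ b) (u' : b ⟶ c) :
    repMap (u ≫ u') = repMap u ≫ repMap u' :=
  (repHom_comp (M := rep b) u (repMap u')).symm

lemma repMap_zero (a b : C) : repMap (0 : a ⟶ b) = 0 := repHom_zero

instance (a : C) : Projective (rep a) where
  factors {E N} f e he := by
    obtain ⟨n, rfl⟩ := exists_eq_repHom f
    obtain ⟨m, rfl⟩ := (epi_iff e).1 he a n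
    exact ⟨repHom m, repHom_comp _ _⟩

open Classical in
/-- The free module on a family of objects `X i`, i.e. the direct sum of the representable
modules `Hom(-, X i)`. -/
noncomputable def free {ι : Type v} (X : ι → C) : RightMod C :=
  ⟨{  obj c := AddCommGrpCat.of (⨁ i, (c.unop ⟶ X i))
      map f := AddCommGrpCat.ofHom (DirectSum.map fun i => Preadditive.leftComp (X i) f.unop)
      map_id c := by
        ext : 1
        refine DirectSum.addHom_ext fun i g => ?_
        simp [DirectSum.map_of, Preadditive.leftComp]
      map_comp f g := by
        ext : 1
        refine DirectSum.addHom_ext fun i g => ?_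
        simp [DirectSum.map_of, Preadditive.leftComp] },
    ⟨fun {c d f g} => by
        ext : 1
        refine DirectSum.addHom_ext fun i g => ?_
        simp [DirectSum.map_of, Preadditive.leftComp]⟩⟩

namespace free

variable {ι : Type v} {X : ι → C}

open Classical in
/-- The element of the free module given by a morphism to one of the `X i`. -/
noncomputable def of {c : C} (i : ι) (g : c ⟶ X i) : (free X).obj.obj (op c) :=
  DirectSum.of (fun i => (c ⟶ X i)) i g

/-- The component in `Hom(c, X i)` of an element of the free module. -/
noncomputable def coord {c : C} (x : (free X).obj.obj (op c)) (i : ι) : c ⟶ X i :=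
  (show ⨁ i, (c ⟶ X i) from x) i

lemma coord_map {c d : C} (f : d ⟶ c) (x : (free X).obj.obj (op c)) (i : ι) :
    coord ((free X).obj.map f.op x) i = f ≫ coord x i := rfl

lemma map_of {c d : C} (f : d ⟶ c) (i : ι) (g : c ⟶ X i) :
    (free X).obj.map f.op (of i g) = of i (f ≫ g) := by
  classical
  exact DirectSum.map_of _ _ _

open Classical in
lemma induction {c : C} {p : (free X).obj.obj (op c) → Prop} (h0 : p 0)
    (hof : ∀ i (g : c ⟶ X i), p (of i g)) (hadd : ∀ x y, p x → p y → p (x + y))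
    (x : (free X).obj.obj (op c)) : p x :=
  DirectSum.induction_on (motive := p) x h0 hof hadd

open Classical in
/-- The morphism from the free module that sends the `i`-th free generator to `m i`. -/
noncomputable def desc {M : RightMod C} (m : ∀ i, M.obj.obj (op (X i))) : free X ⟶ M :=
  ObjectProperty.homMk
    { app c := AddCommGrpCat.ofHom (DirectSum.toAddMonoid fun i =>
        ((repHom (m i)).hom.app c).hom)
      naturality c d f := by
        ext : 1
        refine DirectSum.addHom_ext fun i (g : c.unop ⟶ X i) => ?_
        refine (congrArg (DirectSum.toAddMonoid fun i => ((repHom (m i)).hom.app d).hom)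
          (map_of f.unop i g)).trans ?_
        refine (DirectSum.toAddMonoid_of (β := fun i => (d.unop ⟶ X i)) _ i _).trans ?_
        refine (naturality (repHom (m i)) f.unop g).trans (congrArg (M.obj.map f) ?_)
        exact (DirectSum.toAddMonoid_of (β := fun i => (c.unop ⟶ X i))
          (fun i => ((repHom (m i)).hom.app c).hom) i g).symm }

lemma desc_of {M : RightMod C} (m : ∀ i, M.obj.obj (op (X i))) {c : C} (i : ι) (g : c ⟶ X i) :
    (desc m).hom.app (op c) (of i g) = M.obj.map g.op (m i) := by
  classical
  exact DirectSum.toAddMonoid_of _ _ _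

lemma hom_ext {M : RightMod C} {φ ψ : free X ⟶ M}
    (h : ∀ i, φ.hom.app _ (of i (𝟙 (X i))) = ψ.hom.app _ (of i (𝟙 (X i)))) : φ = ψ := by
  refine RightMod.hom_ext fun c x => ?_
  induction x using induction with
  | h0 => simp
  | hof i g =>
    rw [← Category.comp_id g, ← map_of, naturality, naturality, h]
  | hadd x y hx hy => simp [hx, hy]

lemma exists_eq_sum {c : C} (x : (free X).obj.obj (op c)) :
    ∃ s : Finset ι, x = ∑ i ∈ s, of i (coord x i) := by
  classical
  exact ⟨_, (DirectSum.sum_support_of (show ⨁ i, (c ⟶ X i) from x)).symm⟩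

instance : Projective (free X) where
  factors {E N} f e he := by
    choose m hm using fun i => (epi_iff e).1 he _ (f.hom.app _ (of i (𝟙 (X i))))
    refine ⟨desc m, hom_ext fun i => ?_⟩
    change e.hom.app _ ((desc m).hom.app _ _) = _
    rw [desc_of, map_id_apply, hm]

/-- The free module on representatives of all isomorphism classes of objects is a generator. -/
lemma isSeparator (hX : ∀ c, ∃ i, Nonempty (c ≅ X i)) : IsSeparator (free X) := by
  rw [isSeparator_def]
  intro M N φ ψ h
  refine RightMod.hom_ext fun c x => ?_
  obtain ⟨i, ⟨e⟩⟩ := hX c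
  classical
  -- A morphism `free X ⟶ M` that hits `x` up to the isomorphism `c ≅ X i`.
  let m (j : ι) : M.obj.obj (op (X j)) :=
    if hj : j = i then M.obj.map (eqToHom (by rw [hj]) ≫ e.inv).op x else 0
  have h' := congrArg (fun f : free X ⟶ N => f.hom.app _ (of i e.hom)) (h (desc m))
  change φ.hom.app _ ((desc m).hom.app _ _) = ψ.hom.app _ ((desc m).hom.app _ _) at h'
  rw [desc_of] at h'
  simpa [m, ← map_comp_apply, map_id_apply] using h'

end free

lemma epi_of_surjective {ι : Type v} {X : ι → C} (hX : ∀ c, ∃ i, Nonempty (c ≅ X i))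
    {M N : RightMod C} {φ : M ⟶ N}
    (h : ∀ i, Function.Surjective (φ.hom.app (op (X i)))) : Epi φ := by
  refine (epi_iff φ).2 fun c x => ?_
  obtain ⟨i, ⟨e⟩⟩ := hX c
  obtain ⟨y, hy⟩ := h i (N.obj.map e.inv.op x)
  refine ⟨M.obj.map e.hom.op y, ?_⟩
  rw [naturality, hy, ← map_comp_apply, e.hom_inv_id, map_id_apply]

lemma exists_epi_free {ι : Type v} {X : ι → C} (hX : ∀ c, ∃ i, Nonempty (c ≅ X i))
    (M : RightMod C) : ∃ (κ : Type v) (Y : κ → C) (p : free Y ⟶ M), Epi p := by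
  let m (p : Σ i, M.obj.obj (op (X i))) : M.obj.obj (op (X p.1)) := p.2
  exact ⟨_, _, free.desc m, epi_of_surjective hX fun i x =>
    ⟨free.of ⟨i, x⟩ (𝟙 (X i)), (free.desc_of m _ _).trans (map_id_apply _ _)⟩⟩

lemma enoughProjectives {ι : Type v} {X : ι → C} (hX : ∀ c, ∃ i, Nonempty (c ≅ X i)) :
    EnoughProjectives (RightMod C) where
  presentation M := by
    obtain ⟨_, _, p, _⟩ := exists_epi_free hX M
    exact ⟨{ p := _, f := p }⟩

lemma isGrothendieckAbelian {ι : Type v} {X : ι → C} (hX : ∀ c, ∃ i, Nonempty (c ≅ X i)) :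
    IsGrothendieckAbelian.{v} (RightMod C) where
  locallySmall := ⟨fun M N => by
    refine small_of_injective
      (β := ∀ i, M.obj.obj (op (X i)) → N.obj.obj (op (X i)))
      (f := fun φ i x => φ.hom.app _ x) fun φ ψ h => hom_ext fun c x => ?_
    obtain ⟨i, ⟨e⟩⟩ := hX c
    have h' := congrFun (congrFun h i) (M.obj.map e.inv.op x)
    dsimp only at h'
    rw [naturality, naturality] at h'
    have := congrArg (N.obj.map e.hom.op) h'
    simpa only [← map_comp_apply, e.hom_inv_id, map_id_apply] using this⟩
  hasSeparator := ⟨_, free.isSeparator hX⟩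

end RightMod

end FreeModules

/-! ### Homological functors -/

section Homological

variable {C : Type u} [Category.{v} C] [HasZeroObject C] [HasShift C ℤ] [Preadditive C]
  [∀ k : ℤ, (CategoryTheory.shiftFunctor C k).Additive] [Pretriangulated C]

open Opposite Pretriangulated Abelian

namespace RightMod

lemma isHomological_iff (M : RightMod C) : M.obj.IsHomological ↔
    ∀ T ∈ distTriang C, ∀ y : M.obj.obj (op T.obj₂), M.obj.map T.mor₁.op y = 0 →
      ∃ z : M.obj.obj (op T.obj₃), M.obj.map T.mor₂.op z = y := by
  constructor
  · intro _ T hT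
    exact (ShortComplex.ab_exact_iff _).1 (M.obj.map_distinguished_op_exact T hT)
  · intro h
    refine ⟨fun T hT => ?_⟩
    rw [ShortComplex.ab_exact_iff]
    exact h _ (unop_distinguished T hT)

variable {M : RightMod C} (hM : M.obj.IsHomological)

include hM in
lemma exists_map_mor₂ {T : Triangle C} (hT : T ∈ distTriang C) (y : M.obj.obj (op T.obj₂))
    (hy : M.obj.map T.mor₁.op y = 0) : ∃ z : M.obj.obj (op T.obj₃), M.obj.map T.mor₂.op z = y :=
  M.isHomological_iff.1 hM T hT y hy

include hM in
lemma exists_map_mor₃ {T : Triangle C} (hT : T ∈ distTriang C) (z : M.obj.obj (op T.obj₃))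
    (hz : M.obj.map T.mor₂.op z = 0) :
    ∃ w : M.obj.obj (op (T.obj₁⟦(1 : ℤ)⟧)), M.obj.map T.mor₃.op w = z :=
  exists_map_mor₂ hM (rot_of_distTriang _ hT) z hz

include hM in
/-- Exactness at `M(T.obj₁)`, in which the vanishing on the third vertex of the triangle is
expressed without a shift. -/
lemma exists_map_mor₁ {T : Triangle C} (hT : T ∈ distTriang C) (x : M.obj.obj (op T.obj₁))
    (hx : ∀ (a : C) (h : a ⟶ T.obj₁), h ≫ T.mor₁ = 0 → M.obj.map h.op x = 0) :
    ∃ y : M.obj.obj (op T.obj₂), M.obj.map T.mor₁.op y = x :=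
  exists_map_mor₂ hM (inv_rot_of_distTriang _ hT) x
    (hx _ _ (comp_distTriang_mor_zero₁₂ _ (inv_rot_of_distTriang _ hT)))

section ShortExact

variable {S : ShortComplex (RightMod C)} (hS : S.ShortExact)

include hS

lemma isHomological_X₃ (h₁ : S.X₁.obj.IsHomological) (h₂ : S.X₂.obj.IsHomological) :
    S.X₃.obj.IsHomological := by
  rw [isHomological_iff]
  intro T hT y'' hy''
  obtain ⟨y, rfl⟩ := surjective_of_shortExact hS _ y''
  rw [← naturality] at hy''
  obtain ⟨x', hx'⟩ := (exact_iff S).1 hS.exact _ _ hy''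
  obtain ⟨y', rfl⟩ := exists_map_mor₁ h₁ hT x' fun a h ha =>
    injective_of_shortExact hS _ (by
      rw [naturality, hx', ← map_comp_apply, ha, map_zero_apply, map_zero])
  obtain ⟨z, hz⟩ := exists_map_mor₂ h₂ hT (y - S.f.hom.app _ y') (by
    rw [map_sub, ← naturality, hx', sub_self])
  exact ⟨S.g.hom.app _ z, by rw [← naturality, hz, map_sub, comp_apply_eq_zero, sub_zero]⟩

lemma isHomological_X₁ (h₂ : S.X₂.obj.IsHomological) (h₃ : S.X₃.obj.IsHomological) :
    S.X₁.obj.IsHomological := by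
  rw [isHomological_iff]
  intro T hT y' hy'
  obtain ⟨z, hz⟩ := exists_map_mor₂ h₂ hT (S.f.hom.app _ y') (by
    rw [← naturality, hy', map_zero])
  obtain ⟨w'', hw''⟩ := exists_map_mor₃ h₃ hT (S.g.hom.app _ z) (by
    rw [← naturality, hz, comp_apply_eq_zero])
  obtain ⟨w, rfl⟩ := surjective_of_shortExact hS _ w''
  obtain ⟨z', hz'⟩ := (exact_iff S).1 hS.exact _ (z - S.X₂.obj.map T.mor₃.op w) (by
    rw [map_sub, naturality, hw'', sub_self])
  refine ⟨z', injective_of_shortExact hS _ ?_⟩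
  rw [naturality, hz', map_sub, hz, ← map_comp_apply, comp_distTriang_mor_zero₂₃ _ hT,
    map_zero_apply, sub_zero]

end ShortExact

include hM in
lemma isHomological_of_retract {N : RightMod C} (i : N ⟶ M) (r : M ⟶ N) (h : i ≫ r = 𝟙 N) :
    N.obj.IsHomological := by
  rw [isHomological_iff]
  intro T hT y hy
  have hir (c : C) (x : N.obj.obj (op c)) : r.hom.app _ (i.hom.app _ x) = x :=
    congrArg (fun φ : N ⟶ N => φ.hom.app _ x) h
  obtain ⟨z, hz⟩ := exists_map_mor₂ hM hT (i.hom.app _ y) (by rw [← naturality, hy, map_zero])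
  exact ⟨r.hom.app _ z, by rw [← naturality, hz, hir]⟩

lemma isHomological_free {ι : Type v} (X : ι → C) : (free X).obj.IsHomological := by
  rw [isHomological_iff]
  intro T hT y hy
  have h (i : ι) : ∃ z : T.obj₃ ⟶ X i, T.mor₂ ≫ z = free.coord y i := by
    obtain ⟨z, hz⟩ := Triangle.yoneda_exact₂ T hT (free.coord y i) (by
      rw [← free.coord_map, hy]; rfl)
    exact ⟨z, hz.symm⟩
  choose z hz using h
  obtain ⟨s, hs⟩ := free.exists_eq_sum y
  refine ⟨∑ i ∈ s, free.of i (z i), ?_⟩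
  rw [map_sum, hs]
  exact Finset.sum_congr rfl fun i _ => by rw [free.map_of, hz]

/-- Elements of a free module have finite support: each comes from the universal element of a
representable direct summand. -/
lemma free.exists_retraction {ι : Type v} {X : ι → C} {a : C} (x : (free X).obj.obj (op a)) :
    ∃ (b : C) (y : (free X).obj.obj (op b)) (u : a ⟶ b) (r : free X ⟶ rep b),
      (free X).obj.map u.op y = x ∧ r.hom.app _ y = repOne b := by
  classical
  obtain ⟨s, hs⟩ := free.exists_eq_sum x
  let Y : s → C := fun i => X i
  let q (i : ι) : X i ⟶ biproduct Y := if h : i ∈ s then biproduct.ι Y ⟨i, h⟩ else 0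
  have hq (i : s) : q i = biproduct.ι Y i := dif_pos i.2
  let r : free X ⟶ rep (biproduct Y) := free.desc q
  refine ⟨biproduct Y, ∑ i : s, free.of (X := X) i.1 (biproduct.π Y i),
    biproduct.lift fun i => free.coord x i, r, ?_, ?_⟩
  · rw [map_sum]
    nth_rw 2 [hs]
    rw [← Finset.sum_coe_sort s]
    exact Finset.sum_congr rfl fun i _ => by
      rw [free.map_of]
      exact congrArg _ (biproduct.lift_π _ _)
  · rw [map_sum]
    refine Eq.trans (Finset.sum_congr rfl fun i _ => ?_) (IsBilimit.total (biproduct.isBilimit Y))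
    exact (free.desc_of _ _ _).trans (congrArg (biproduct.π Y i ≫ ·) (hq i))

lemma isHomological_of_projective (P : RightMod C) [Projective P]
    {ι : Type v} {X : ι → C} (hX : ∀ c, ∃ i, Nonempty (c ≅ X i)) : P.obj.IsHomological := by
  obtain ⟨κ, Y, p, _⟩ := exists_epi_free hX P
  exact isHomological_of_retract (isHomological_free Y) (Projective.factorThru (𝟙 P) p) p
    (Projective.factorThru_comp _ _)

/-- The sequence of representable modules given by a distinguished triangle. -/
abbrev repShortComplex {T : Triangle C} (hT : T ∈ distTriang C) : ShortComplex (RightMod C) :=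
  ShortComplex.mk (repMap T.mor₁) (repMap T.mor₂) (by
    rw [← repMap_comp, comp_distTriang_mor_zero₁₂ _ hT, repMap_zero])

lemma repShortComplex_exact {T : Triangle C} (hT : T ∈ distTriang C) :
    (repShortComplex hT).Exact := by
  rw [exact_iff]
  intro c (g : c ⟶ T.obj₂) (hg : g ≫ T.mor₂ = 0)
  obtain ⟨k, hk⟩ := T.coyoneda_exact₂ hT g hg
  exact ⟨k, hk.symm⟩

/-- For a distinguished triangle `z ⟶ a ⟶ b`, the image of `Hom(-, a) ⟶ Hom(-, b)` is the
cokernel of `Hom(-, z) ⟶ Hom(-, a)`. -/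
lemma shortExact_cokernel_repMap {z a b : C} {w : z ⟶ a} {u : a ⟶ b} {t : b ⟶ z⟦(1 : ℤ)⟧}
    (hT : Triangle.mk w u t ∈ distTriang C) (h : repMap w ≫ repMap u = 0) :
    (ShortComplex.mk (cokernel.desc (repMap w) (repMap u) h) (cokernel.π (repMap u)) (by
        rw [← cancel_epi (cokernel.π _), cokernel.π_desc_assoc]; simp)).ShortExact := by
  have hm : Mono (cokernel.desc (repMap w) (repMap u) h) :=
    (repShortComplex_exact hT).mono_cokernelDesc
  refine ShortComplex.ShortExact.mk' ?_ hm inferInstance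
  let S : ShortComplex (RightMod C) := ShortComplex.mk _ _ (cokernel.condition (repMap u))
  have hS : S.Exact := ShortComplex.exact_of_g_is_cokernel _ (cokernelIsCokernel _)
  let φ : S ⟶ ShortComplex.mk (cokernel.desc (repMap w) (repMap u) h) (cokernel.π (repMap u))
      (by rw [← cancel_epi (cokernel.π _), cokernel.π_desc_assoc]; simp) :=
    { τ₁ := cokernel.π _, τ₂ := 𝟙 _, τ₃ := 𝟙 _ }
  have : Epi φ.τ₁ := inferInstanceAs (Epi (cokernel.π _))
  have : IsIso φ.τ₂ := inferInstanceAs (IsIso (𝟙 _))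
  have : Mono φ.τ₃ := inferInstanceAs (Mono (𝟙 _))
  exact (ShortComplex.exact_iff_of_epi_of_isIso_of_mono φ).1 hS

include hM in
/-- A homological functor `M` has the extension property with respect to the inclusion of the image
of `Hom(-, a) ⟶ Hom(-, b)` in `Hom(-, b)`. -/
lemma exists_extension_cokernel_repMap {z a b : C} {w : z ⟶ a} {u : a ⟶ b}
    {t : b ⟶ z⟦(1 : ℤ)⟧} (hT : Triangle.mk w u t ∈ distTriang C)
    (h : repMap w ≫ repMap u = 0) (φ : cokernel (repMap w) ⟶ M) :
    ∃ ψ : rep b ⟶ M, cokernel.desc (repMap w) (repMap u) h ≫ ψ = φ := by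
  obtain ⟨m, hm⟩ := exists_eq_repHom (cokernel.π (repMap w) ≫ φ)
  obtain ⟨m', rfl⟩ : ∃ m', M.obj.map u.op m' = m := exists_map_mor₂ hM hT m (by
    have h₀ := cokernel.condition_assoc (repMap w) φ
    rw [hm, repMap_comp_repHom, zero_comp, ← repHom_zero] at h₀
    exact repHom_injective h₀)
  refine ⟨repHom m', ?_⟩
  rw [← cancel_epi (cokernel.π (repMap w)), hm, cokernel.π_desc_assoc, repMap_comp_repHom]

lemma isHomological_of_injective (E : RightMod C) [Injective E] : E.obj.IsHomological := by
  rw [isHomological_iff]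
  intro T hT y hy
  have hw : repMap T.mor₁ ≫ repHom y = 0 := by
    rw [repMap_comp_repHom, hy, repHom_zero]
  obtain ⟨z, hz⟩ := exists_eq_repHom ((repShortComplex_exact hT).descToInjective (repHom y) hw)
  have := (repShortComplex_exact hT).comp_descToInjective (repHom y) hw
  rw [hz] at this
  refine ⟨z, ?_⟩
  rw [← repHom_apply_one y, ← this, repMap_comp_repHom, repHom_apply_one]

lemma isHomological_of_hasFiniteProjDim {ι : Type v} {X : ι → C}
    (hX : ∀ c, ∃ i, Nonempty (c ≅ X i)) (h : HasFiniteProjDim M) : M.obj.IsHomological := by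
  have := enoughProjectives hX
  obtain ⟨d, hd⟩ := h
  induction d generalizing M with
  | zero =>
    have := (projective_iff_hasProjectiveDimensionLE_zero M).2 hd
    exact isHomological_of_projective M hX
  | succ d ih =>
    obtain ⟨S, hS, _, rfl⟩ := exists_shortExact_projective M
    exact isHomological_X₃ hS (ih ((hS.hasProjectiveDimensionLT_X₃_iff d inferInstance).1 hd))
      (isHomological_of_projective _ hX)

lemma isHomological_of_hasFiniteInjDim [EnoughInjectives (RightMod C)] (h : HasFiniteInjDim M) :
    M.obj.IsHomological := by
  obtain ⟨d, hd⟩ := h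
  induction d generalizing M with
  | zero =>
    have := injective_iff_hasInjectiveDimensionLT_one.2 hd
    exact isHomological_of_injective M
  | succ d ih =>
    obtain ⟨S, hS, _, rfl⟩ := exists_shortExact_injective M
    exact isHomological_X₁ hS (isHomological_of_injective _)
      (ih ((hS.hasInjectiveDimensionLT_X₃_iff d inferInstance).2 hd))

section Ext

variable [HasExt.{w} (RightMod C)]

include hM in
/-- A homological functor has no higher extensions by finitely presented modules. -/
lemma subsingleton_ext_cokernel_repMap {a b : C} (u : a ⟶ b) (j : ℕ) :
    Subsingleton (Ext (cokernel (repMap u)) M (j + 1)) := by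
  induction j generalizing a b with
  | zero =>
    obtain ⟨z, w, t, hT⟩ := distinguished_cocone_triangle₁ u
    exact subsingleton_ext_one_of_extend
      (shortExact_cokernel_repMap hT (repShortComplex hT).zero)
      (exists_extension_cokernel_repMap hM hT (repShortComplex hT).zero)
  | succ j ih =>
    obtain ⟨z, w, t, hT⟩ := distinguished_cocone_triangle₁ u
    exact (subsingleton_ext_shift_left
      (shortExact_cokernel_repMap hT (repShortComplex hT).zero) M j).2 (ih w)

include hM in
/-- A homological functor has no higher extensions by the quotient of a free module by a cyclic
submodule. -/
lemma subsingleton_ext_cokernel_repHom {ι : Type v} {X : ι → C} {a : C}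
    (x : (free X).obj.obj (op a)) (j : ℕ) :
    Subsingleton (Ext (cokernel (repHom x)) M (j + 1)) := by
  obtain ⟨b, y, u, r, rfl, hr⟩ := free.exists_retraction x
  have hry : repHom y ≫ r = 𝟙 (rep b) := by
    refine rep_hom_ext ?_
    rw [repHom_comp, hr, repHom_apply_one]
    rfl
  have : Mono (repHom y) := mono_of_mono_fac hry
  have : Projective (cokernel (repHom y)) := by
    refine Retract.projective (Y := free X) ⟨cokernel.desc (repHom y) (𝟙 _ - r ≫ repHom y) ?_,
      cokernel.π _, ?_⟩
    · rw [Preadditive.comp_sub, reassoc_of% hry, Category.comp_id, sub_self]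
    · rw [← cancel_epi (cokernel.π _), cokernel.π_desc_assoc, Preadditive.sub_comp]
      simp
  rw [← repMap_comp_repHom]
  exact subsingleton_ext_X₂ (shortExact_cokernel_comp (repMap u) (repHom y))
    (subsingleton_ext_cokernel_repMap hM u j)
    (subsingleton_of_forall_eq 0 fun e => e.eq_zero_of_projective)

end Ext

end RightMod

end Homological

/-! ### The injective dimension of homological functors -/

section Cardinality

variable {C : Type u} [Category.{v} C]

/-- A category with a skeleton of at most `ℵ_n` morphisms has, up to isomorphism, a small family
of objects with at most `ℵ_n` morphisms between them. -/
lemma exists_small_family {n : ℕ}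
    (hC : Cardinal.mk (Arrow (Skeleton C)) ≤ Cardinal.aleph n) :
    ∃ (ι : Type v) (X : ι → C), (∀ c, ∃ i, Nonempty (c ≅ X i)) ∧
      Cardinal.mk (Σ p : ι × ι, (X p.1 ⟶ X p.2)) ≤ Cardinal.aleph n := by
  obtain ⟨f⟩ : Nonempty (Arrow (Skeleton C) ↪ (Cardinal.aleph.{v} n).out) := by
    rw [← Cardinal.lift_mk_le']
    simpa using hC
  have hg : Function.Injective (fun s : Skeleton C => f (Arrow.mk (𝟙 s))) := fun s t h =>
    congrArg Arrow.leftFunc.obj (f.injective h)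
  have := small_of_injective hg
  let e := equivShrink.{v} (Skeleton C)
  let X (i : Shrink.{v} (Skeleton C)) : C := (fromSkeleton C).obj (e.symm i)
  refine ⟨_, X, fun c => ?_, ?_⟩
  · refine ⟨e (toSkeleton c), ⟨Iso.symm ?_⟩⟩
    exact eqToIso (by simp [X]) ≪≫ fromSkeletonToSkeletonIso c
  · rw [← Cardinal.mk_out (Cardinal.aleph n)]
    refine Cardinal.mk_le_of_injective (f := fun p =>
      f (Arrow.mk (InducedCategory.homMk p.2 : e.symm p.1.1 ⟶ e.symm p.1.2))) ?_
    rintro ⟨⟨i, j⟩, g⟩ ⟨⟨i', j'⟩, g'⟩ h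
    have h := f.injective h
    obtain rfl : i = i' := e.symm.injective (congrArg Arrow.leftFunc.obj h)
    obtain rfl : j = j' := e.symm.injective (congrArg Arrow.rightFunc.obj h)
    have h := Arrow.mk_injective _ _ h
    obtain rfl : g = g' := congrArg (fun k : e.symm i ⟶ e.symm j => k.hom) h
    rfl

end Cardinality

section Generator

variable {C : Type u} [Category.{v} C] [Preadditive C]

open Opposite

namespace RightMod

/-- The free module on the `X i` has at most `ℵ_n` elements, as they are finite sums of morphisms. -/
lemma mk_elements_free_le {n : ℕ} {ι : Type v} (X : ι → C)
    (h : Cardinal.mk (Σ p : ι × ι, (X p.1 ⟶ X p.2)) ≤ Cardinal.aleph n) :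
    Cardinal.mk (Σ i, (free X).obj.obj (op (X i))) ≤ Cardinal.aleph n := by
  classical
  let E := Σ p : ι × ι, (X p.1 ⟶ X p.2)
  have hι : Cardinal.mk ι ≤ Cardinal.aleph n :=
    (Cardinal.mk_le_of_injective (f := fun i => (⟨(i, i), 𝟙 _⟩ : E))
      fun i j hij => congrArg (fun e : E => e.1.1) hij).trans h
  let t (i : ι) (e : E) : (free X).obj.obj (op (X i)) :=
    if hi : i = e.1.1 then free.of e.1.2 (eqToHom (by rw [hi]) ≫ e.2) else 0
  have hf : Function.Surjective (fun p : ι × List E =>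
      (⟨p.1, (p.2.map (t p.1)).sum⟩ : Σ i, (free X).obj.obj (op (X i)))) := by
    rintro ⟨i, x⟩
    obtain ⟨l, hl⟩ : ∃ l : List E, (l.map (t i)).sum = x := by
      induction x using free.induction with
      | h0 => exact ⟨[], rfl⟩
      | hof j g => exact ⟨[⟨(i, j), g⟩], by simp [t]⟩
      | hadd x y hx hy =>
        obtain ⟨l, rfl⟩ := hx
        obtain ⟨l', rfl⟩ := hy
        exact ⟨l ++ l', by simp⟩
    exact ⟨(i, l), by rw [← hl]⟩
  refine (Cardinal.mk_le_of_surjective hf).trans ?_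
  have hE : Cardinal.mk (List E) ≤ Cardinal.aleph n :=
    (Cardinal.mk_list_le_max E).trans (max_le (Cardinal.aleph0_le_aleph _) h)
  rw [Cardinal.mk_prod, Cardinal.lift_id, Cardinal.lift_id]
  exact (mul_le_mul' hι hE).trans_eq (Cardinal.mul_eq_self (Cardinal.aleph0_le_aleph _))

lemma le_of_forall_factors {ι : Type v} {X : ι → C} (hX : ∀ c, ∃ i, Nonempty (c ≅ X i))
    {M : RightMod C} {K N : Subobject M}
    (h : ∀ i (x : M.obj.obj (op (X i))), K.Factors (repHom x) → N.Factors (repHom x)) :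
    K ≤ N := by
  have h₀ : K.arrow ≫ cokernel.π N.arrow = 0 := by
    refine hom_ext fun c x => ?_
    obtain ⟨i, ⟨e⟩⟩ := hX c
    have h₁ := h i (K.arrow.hom.app _ ((K : RightMod C).obj.map e.inv.op x)) (by
      rw [← repHom_comp]
      exact Subobject.factors_comp_arrow _)
    have h₂ : repHom (K.arrow.hom.app _ ((K : RightMod C).obj.map e.inv.op x)) ≫
        cokernel.π N.arrow = 0 := by
      rw [← Subobject.factorThru_arrow _ _ h₁, Category.assoc, cokernel.condition, comp_zero]
    rw [← repHom_comp, Category.assoc, repHom_comp, ← repHom_zero] at h₂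
    have h₃ := repHom_injective h₂
    rw [naturality] at h₃
    have h₄ := congrArg ((cokernel N.arrow).obj.map e.hom.op) h₃
    rwa [← map_comp_apply, e.hom_inv_id, map_id_apply, map_zero] at h₄
  exact Subobject.le_of_comm (Abelian.monoLift N.arrow K.arrow h₀) (Abelian.monoLift_comp _ _ _)

lemma imageSubobject_repHom_le {M : RightMod C} {a : C} (x : M.obj.obj (op a))
    {K : Subobject M} : imageSubobject (repHom x) ≤ K ↔ K.Factors (repHom x) := by
  refine ⟨fun h => Subobject.factors_of_le _ h ?_, fun h =>
    imageSubobject_le _ (K.factorThru _ h) (K.factorThru_arrow _ h)⟩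
  simpa using imageSubobject_factors_comp_self (repHom x) (𝟙 _)

/-- Every submodule is the sum of the cyclic submodules that it contains. -/
lemma exists_isLUB_imageSubobject {ι : Type v} {X : ι → C}
    (hX : ∀ c, ∃ i, Nonempty (c ≅ X i)) {M : RightMod C} (K : Subobject M) :
    ∃ s : Set (Σ i, M.obj.obj (op (X i))),
      IsLUB ((fun p => imageSubobject (repHom p.2)) '' s) K := by
  refine ⟨{p | imageSubobject (repHom p.2) ≤ K}, ?_, fun N hN => ?_⟩
  · rintro _ ⟨p, hp, rfl⟩
    exact hp
  · refine le_of_forall_factors hX fun i x hx => ?_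
    rw [← imageSubobject_repHom_le] at hx ⊢
    exact hN ⟨⟨i, x⟩, hx, rfl⟩

/-- In the presence of biproducts, a finite sum of cyclic submodules is cyclic. -/
lemma exists_isLUB_imageSubobject_of_finite [HasZeroObject C] [HasBinaryBiproducts C]
    {I : Type v} {M : RightMod C} (c : I → C) (x : ∀ i, M.obj.obj (op (c i))) (s : Set I)
    (hs : s.Finite) : ∃ (a : C) (y : M.obj.obj (op a)),
      IsLUB ((fun i => imageSubobject (repHom (x i))) '' s) (imageSubobject (repHom y)) := by
  induction s, hs using Set.Finite.induction_on with
  | empty => exact ⟨0, 0, by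
      rw [Set.image_empty, isLUB_empty_iff, repHom_zero, imageSubobject_zero]
      exact fun K => OrderBot.bot_le K⟩
  | @insert i s _ _ ih =>
    obtain ⟨a, y, hy⟩ := ih
    let w : M.obj.obj (op (c i ⊞ a)) :=
      M.obj.map biprod.fst.op (x i) + M.obj.map biprod.snd.op y
    have h₁ : M.obj.map biprod.inl.op w = x i := by
      rw [map_add, ← map_comp_apply, ← map_comp_apply, biprod.inl_fst, biprod.inl_snd,
        map_id_apply, map_zero_apply, add_zero]
    have h₂ : M.obj.map biprod.inr.op w = y := by
      rw [map_add, ← map_comp_apply, ← map_comp_apply, biprod.inr_fst, biprod.inr_snd,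
        map_id_apply, map_zero_apply, zero_add]
    refine ⟨c i ⊞ a, w, ?_⟩
    have hw : imageSubobject (repHom w) =
        imageSubobject (repHom (x i)) ⊔ imageSubobject (repHom y) := by
      apply le_antisymm
      · rw [imageSubobject_repHom_le, repHom_add, ← repMap_comp_repHom, ← repMap_comp_repHom]
        refine Subobject.factors_add _ _ (Subobject.factors_of_factors_right _ ?_)
          (Subobject.factors_of_factors_right _ ?_)
        · exact (imageSubobject_repHom_le _).1 le_sup_left
        · exact (imageSubobject_repHom_le _).1 le_sup_right
      · rw [sup_le_iff, imageSubobject_repHom_le, imageSubobject_repHom_le]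
        constructor
        · rw [← h₁, ← repMap_comp_repHom]
          exact imageSubobject_factors_comp_self _ _
        · rw [← h₂, ← repMap_comp_repHom]
          exact imageSubobject_factors_comp_self _ _
    rw [Set.image_insert_eq, hw]
    exact hy.insert _

end RightMod

end Generator

section InjectiveDimension

variable {C : Type u} [Category.{v} C] [HasZeroObject C] [HasShift C ℤ] [Preadditive C]
  [∀ k : ℤ, (CategoryTheory.shiftFunctor C k).Additive] [Pretriangulated C]

open Opposite Abelian

namespace RightMod

/-- Homological functors have injective dimension at most `n + 1`: they have no higher extensions
by the finitely presented quotients of a free generator, which has at most `ℵ_n` elements. -/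
lemma hasInjectiveDimensionLE_of_isHomological {n : ℕ} {ι : Type v} {X : ι → C}
    (hX : ∀ c, ∃ i, Nonempty (c ≅ X i))
    (hn : Cardinal.mk (Σ p : ι × ι, (X p.1 ⟶ X p.2)) ≤ Cardinal.aleph n)
    {M : RightMod C} (hM : M.obj.IsHomological) : HasInjectiveDimensionLE M (n + 1) := by
  have := isGrothendieckAbelian hX
  let := HasExt.standard (RightMod C)
  refine hasInjectiveDimensionLE_of_isLUB (free.isSeparator hX) _ (mk_elements_free_le X hn) M
    (exists_isLUB_imageSubobject hX) fun s hs => ?_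
  obtain ⟨a, y, hy⟩ := exists_isLUB_imageSubobject_of_finite _ (fun p => p.2) s hs
  refine ⟨_, hy, fun j => subsingleton_ext_of_iso_left ?_ _ _
    (subsingleton_ext_cokernel_repHom hM y j)⟩
  exact cokernelIsoOfEq (imageSubobject_arrow_comp (repHom y)).symm ≪≫ cokernelEpiComp _ _

end RightMod

end InjectiveDimension

/-! ### The tensor product of modules -/

section TensorProduct

variable {C : Type u} [Category.{v} C] [Preadditive C]

open Opposite

namespace ModTensor

variable {M : RightMod C} {N : LeftMod C}

/-- The element `m ⊗ n` of `M ⊗_C N`, for `m ∈ M(c)` and `n ∈ N(c)`. -/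
noncomputable def tmul (c : C) (m : M.obj.obj (op c)) (n : N.obj.obj c) : ModTensor M N :=
  QuotientAddGroup.mk' _ (TensorSum.tmul M N c m n)

lemma tmul_add (c : C) (m : M.obj.obj (op c)) (n n' : N.obj.obj c) :
    tmul c m (n + n') = tmul c m n + tmul c m n' := by
  rw [tmul, tmul, tmul, ← map_add, TensorSum.tmul, TensorProduct.tmul_add, map_add]
  rfl

lemma tmul_zero (c : C) (m : M.obj.obj (op c)) : tmul c m (0 : N.obj.obj c) = 0 := by
  rw [tmul, TensorSum.tmul, TensorProduct.tmul_zero, map_zero, map_zero]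

lemma zero_tmul (c : C) (n : N.obj.obj c) : tmul c (0 : M.obj.obj (op c)) n = 0 := by
  rw [tmul, TensorSum.tmul, TensorProduct.zero_tmul, map_zero, map_zero]

lemma map_tmul {c d : C} (f : c ⟶ d) (m : M.obj.obj (op d)) (n : N.obj.obj c) :
    tmul c (M.obj.map f.op m) n = tmul d m (N.obj.map f n) := by
  rw [← sub_eq_zero, tmul, tmul, ← map_sub]
  exact (QuotientAddGroup.eq_zero_iff _).2
    (AddSubgroup.subset_closure ⟨c, d, f, m, n, rfl⟩)

lemma modTensorMap_tmul {N' : LeftMod C} (φ : N ⟶ N') (c : C) (m : M.obj.obj (op c))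
    (n : N.obj.obj c) : modTensorMap M φ (tmul c m n) = tmul c m (φ.hom.app c n) :=
  congrArg (QuotientAddGroup.mk' _) (tensorSumMap_tmul M φ c m n)

lemma induction {p : ModTensor M N → Prop} (h0 : p 0) (ht : ∀ c m n, p (tmul c m n))
    (hadd : ∀ x y, p x → p y → p (x + y)) (x : ModTensor M N) : p x := by
  classical
  obtain ⟨x, rfl⟩ := QuotientAddGroup.mk'_surjective _ x
  induction x using DirectSum.induction_on with
  | zero => simpa using h0
  | of c x =>
    induction x using TensorProduct.induction_on with
    | zero => simpa using h0
    | tmul m n => exact ht c m n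
    | add x y hx hy => rw [map_add, map_add]; exact hadd _ _ hx hy
  | add x y hx hy => rw [map_add]; exact hadd _ _ hx hy

/-- The universal property of `M ⊗_C N`: balanced families of biadditive maps factor through it. -/
lemma exists_lift {A : Type*} [AddCommGroup A]
    (b : ∀ c, M.obj.obj (op c) →+ N.obj.obj c →+ A)
    (hb : ∀ (c d : C) (f : c ⟶ d) (m : M.obj.obj (op d)) (n : N.obj.obj c),
      b c (M.obj.map f.op m) n = b d m (N.obj.map f n)) :
    ∃ l : ModTensor M N →+ A, ∀ c m n, l (tmul c m n) = b c m n := by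
  classical
  let l₀ : TensorSum M N →+ A := DirectSum.toAddMonoid fun c =>
    TensorProduct.liftAddHom (b c) fun r m n => by simp
  have hl₀ (c m n) : l₀ (TensorSum.tmul M N c m n) = b c m n :=
    (DirectSum.toAddMonoid_of _ _ _).trans (TensorProduct.liftAddHom_tmul _ _ _ _)
  refine ⟨QuotientAddGroup.lift _ l₀ ((AddSubgroup.closure_le _).2 ?_), hl₀⟩
  rintro _ ⟨c, d, f, m, n, rfl⟩
  change l₀ _ = 0
  rw [map_sub, hl₀, hl₀, hb, sub_self]

end ModTensor

end TensorProduct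

/-! ### Flat modules and homological functors -/

section FlatHomological

variable {C : Type u} [Category.{v} C] [Preadditive C]

open Opposite

/-- The left module of the morphisms from `X` that factor through `f : X ⟶ Y`, i.e. the image of
`Hom(Y, -) ⟶ Hom(X, -)`. -/
def LeftMod.image {X Y : C} (f : X ⟶ Y) : LeftMod C :=
  ⟨{  obj c := AddCommGrpCat.of (Preadditive.leftComp c f).range
      map {c d} k := AddCommGrpCat.ofHom
        (((Preadditive.rightComp X k).comp (Preadditive.leftComp c f).range.subtype).codRestrict
          (Preadditive.leftComp d f).range (by
            rintro ⟨_, h, rfl⟩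
            exact ⟨h ≫ k, (Category.assoc _ _ _).symm⟩))
      map_id c := by ext ⟨x, hx⟩; exact Category.comp_id x
      map_comp k l := by ext ⟨x, hx⟩; exact (Category.assoc x k l).symm },
    ⟨fun {c d k l} => by ext ⟨x, hx⟩; exact Preadditive.comp_add _ _ _ x k l⟩⟩

/-- The inclusion of `LeftMod.image f` in `Hom(X, -)`. -/
def LeftMod.imageι {X Y : C} (f : X ⟶ Y) :
    LeftMod.image f ⟶ AdditiveFunctor.of (preadditiveCoyoneda.obj (op X)) :=
  ObjectProperty.homMk { app c := AddCommGrpCat.ofHom (Preadditive.leftComp c f).range.subtype }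

namespace RightMod

/-- For a flat module, `M(Z) ⟶ M(Y) ⟶ M(X)` is exact if `g : Y ⟶ Z` is a weak cokernel of
`f : X ⟶ Y`. -/
lemma exists_map_eq_of_isFlatMod {M : RightMod C} (hM : IsFlatMod M) {X Y Z : C} (f : X ⟶ Y)
    (g : Y ⟶ Z) (hg : ∀ (c : C) (h : Y ⟶ c), f ≫ h = 0 → ∃ h', h = g ≫ h')
    (y : M.obj.obj (op Y)) (hy : M.obj.map f.op y = 0) :
    ∃ z, M.obj.map g.op z = y := by
  -- With `I` the image of `Hom(Y, -) ⟶ Hom(X, -)`, the element `y ⊗ f` of `M ⊗ I` vanishes, as it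
  -- does so in `M ⊗ Hom(X, -)`. It is sent to the class of `y` by the map `M ⊗ I ⟶ M(Y) / M(Z)`,
  -- `m ⊗ (f ≫ h) ↦ M(h)(m)`, which is well defined since `g` is a weak cokernel of `f`.
  let Q := M.obj.obj (op Y) ⧸ (M.obj.map g.op).hom.range
  let q : M.obj.obj (op Y) →+ Q := QuotientAddGroup.mk' _
  have hq {c : C} (h h' : Y ⟶ c) (e : f ≫ h = f ≫ h') (m : M.obj.obj (op c)) :
      q (M.obj.map h.op m) = q (M.obj.map h'.op m) := by
    obtain ⟨k, hk⟩ := hg c (h - h') (by rw [Preadditive.comp_sub, e, sub_self])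
    rw [← sub_eq_zero, ← map_sub, ← map_sub_apply, hk, map_comp_apply]
    exact (QuotientAddGroup.eq_zero_iff _).2 ⟨_, rfl⟩
  let s {c : C} (n : (LeftMod.image f).obj.obj c) : Y ⟶ c := n.2.choose
  have hs {c : C} (n : (LeftMod.image f).obj.obj c) : f ≫ s n = n.1 := n.2.choose_spec
  obtain ⟨l, hl⟩ := ModTensor.exists_lift (M := M) (N := LeftMod.image f)
    (fun c => AddMonoidHom.mk' (fun m => AddMonoidHom.mk' (fun n => q (M.obj.map (s n).op m))
      fun n n' => by
        rw [← map_add, ← map_add_apply]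
        refine hq _ _ ?_ _
        rw [Preadditive.comp_add, hs, hs, hs]
        rfl) fun m m' => by
        ext n
        exact (congrArg q (map_add _ _ _)).trans (map_add q _ _)) (fun c d k m n => by
      change q _ = q _
      rw [← map_comp_apply]
      refine hq _ _ ?_ _
      rw [hs, reassoc_of% (hs n)]
      rfl)
  let n₀ : (LeftMod.image f).obj.obj Y := ⟨f, 𝟙 Y, Category.comp_id f⟩
  have h₀ : ModTensor.tmul Y y n₀ = 0 := by
    refine hM (LeftMod.imageι f) (fun c => Subtype.val_injective) ?_
    rw [map_zero, ModTensor.modTensorMap_tmul]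
    let e : (AdditiveFunctor.of (preadditiveCoyoneda.obj (op X))).obj.obj X := 𝟙 X
    have : (LeftMod.imageι f).hom.app Y n₀ = (AdditiveFunctor.of
      (preadditiveCoyoneda.obj (op X))).obj.map f e := (Category.id_comp f).symm
    rw [this, ← ModTensor.map_tmul, hy, ModTensor.zero_tmul]
  have h₁ := hl Y y n₀
  rw [h₀, map_zero] at h₁
  have h₂ : q y = 0 := by
    refine Eq.trans ?_ h₁.symm
    rw [← M.map_id_apply y]
    refine (hq _ _ ?_ _).trans
      (congrArg (fun z => q (M.obj.map (s n₀).op z)) (M.map_id_apply y).symm)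
    rw [hs]
    exact Category.comp_id f
  exact (QuotientAddGroup.eq_zero_iff _).1 h₂

section Elements

/-- The category of elements of a right module `M`: an object is an element of some `M(c)`, and a
morphism from `m` to `m'` is a morphism `f` of `C` such that `M(f)(m') = m`. -/
structure El (M : RightMod C) where
  /-- The object at which the element lives. -/
  pt : C
  /-- The element. -/
  elt : M.obj.obj (op pt)

variable {M : RightMod C}

/-- Morphisms are lifted to the universe of the objects, so that this is a small category. -/
instance : Category.{max u v} (El M) where
  Hom x y := ULift.{u} { f : x.pt ⟶ y.pt // M.obj.map f.op y.elt = x.elt }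
  id x := ⟨𝟙 _, M.map_id_apply _⟩
  comp f g := ⟨f.down.1 ≫ g.down.1, by rw [map_comp_apply, g.down.2, f.down.2]⟩
  id_comp f := ULift.ext _ _ (Subtype.ext (Category.id_comp f.down.1))
  comp_id f := ULift.ext _ _ (Subtype.ext (Category.comp_id f.down.1))
  assoc f g h := ULift.ext _ _ (Subtype.ext (Category.assoc f.down.1 g.down.1 h.down.1))

/-- The composition of the projection from the category of elements with a left module, with
values lifted to the universe of the category of elements. -/
def El.functor (M : RightMod C) (N : LeftMod C) : El M ⥤ AddCommGrpCat.{max u v} where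
  obj x := AddCommGrpCat.of (ULift.{u} (N.obj.obj x.pt))
  map f := AddCommGrpCat.ofHom (AddEquiv.ulift.symm.toAddMonoidHom.comp
    ((N.obj.map f.down.1).hom.comp AddEquiv.ulift.toAddMonoidHom))
  map_id x := by
    ext n
    exact (congrArg (fun k : N.obj.obj x.pt ⟶ _ => k n.down) (N.obj.map_id x.pt))
  map_comp {x y z} f g := by
    ext n
    exact (congrArg (fun k : N.obj.obj x.pt ⟶ _ => k n.down)
      (N.obj.map_comp f.down.1 g.down.1))

end Elements

/-- The tensor product `M ⊗_C N` maps to the colimit of `N` over the category of elements of `M`.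
If that category is filtered, an equation `m ⊗ n = 0` already holds at some stage of the
colimit. -/
lemma exists_of_tmul_eq_zero [HasBinaryBiproducts C] {M : RightMod C} [IsFiltered (El M)]
    {N : LeftMod C} {c : C} (m : M.obj.obj (op c)) (n : N.obj.obj c)
    (h : ModTensor.tmul c m n = 0) :
    ∃ (d : C) (f : c ⟶ d) (m' : M.obj.obj (op d)),
      M.obj.map f.op m' = m ∧ N.obj.map f n = 0 := by
  let F := El.functor M N
  let i (c : C) (m : M.obj.obj (op c)) : N.obj.obj c →+ (colimit F : AddCommGrpCat.{max u v}) :=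
    (colimit.ι F ⟨c, m⟩).hom.comp AddEquiv.ulift.symm.toAddMonoidHom
  have hi {c d : C} (f : c ⟶ d) (m : M.obj.obj (op d)) (n : N.obj.obj c) :
      i c (M.obj.map f.op m) n = i d m (N.obj.map f n) := by
    let k : (⟨c, M.obj.map f.op m⟩ : El M) ⟶ ⟨d, m⟩ := ⟨f, rfl⟩
    exact (congrArg (fun t : F.obj _ ⟶ _ => t (ULift.up n)) (colimit.w F k)).symm
  have hadd {c : C} (m m' : M.obj.obj (op c)) (n : N.obj.obj c) :
      i c (m + m') n = i c m n + i c m' n := by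
    -- Additivity in `m` is obtained by pulling back along the diagonal of `c ⊞ c` the element with
    -- components `m` and `m'`.
    let w : M.obj.obj (op (c ⊞ c)) := M.obj.map biprod.fst.op m + M.obj.map biprod.snd.op m'
    have h₁ : M.obj.map biprod.inl.op w = m := by
      rw [map_add, ← map_comp_apply, ← map_comp_apply, biprod.inl_fst, biprod.inl_snd,
        map_id_apply, map_zero_apply, add_zero]
    have h₂ : M.obj.map biprod.inr.op w = m' := by
      rw [map_add, ← map_comp_apply, ← map_comp_apply, biprod.inr_fst, biprod.inr_snd,
        map_id_apply, map_zero_apply, zero_add]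
    have h₃ : M.obj.map (biprod.inl + biprod.inr : c ⟶ c ⊞ c).op w = m + m' := by
      rw [map_add_apply, h₁, h₂]
    have h₄ : N.obj.map (biprod.inl + biprod.inr : c ⟶ c ⊞ c) n =
        N.obj.map biprod.inl n + N.obj.map biprod.inr n := by
      rw [N.obj.map_add]; rfl
    rw [← h₃, hi, h₄, map_add, ← hi, ← hi, h₁, h₂]
  obtain ⟨l, hl⟩ := ModTensor.exists_lift (M := M) (N := N)
    (fun c => AddMonoidHom.mk' (i c) fun m m' => by ext n; exact hadd m m' n)
    (fun c d f m n => hi f m n)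
  have h₀ : colimit.ι F ⟨c, m⟩ (ULift.up n) = colimit.ι F ⟨c, m⟩ 0 := by
    have := hl c m n
    rw [h, map_zero] at this
    rw [map_zero]
    exact this.symm
  obtain ⟨⟨d, m'⟩, f, g, hfg⟩ := Concrete.colimit_exists_of_rep_eq.{max u v} F _ _ h₀
  refine ⟨d, f.down.1, m', f.down.2, ?_⟩
  rw [map_zero] at hfg
  exact congrArg ULift.down hfg

/-- In the presence of biproducts, all elements of the tensor product are pure tensors. -/
lemma exists_eq_tmul [HasZeroObject C] [HasBinaryBiproducts C] {M : RightMod C} {N : LeftMod C}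
    (x : ModTensor M N) : ∃ c m n, x = ModTensor.tmul c m n := by
  induction x using ModTensor.induction with
  | h0 => exact ⟨0, 0, 0, (ModTensor.tmul_zero _ _).symm⟩
  | ht c m n => exact ⟨c, m, n, rfl⟩
  | hadd x y hx hy =>
    obtain ⟨c, m, n, rfl⟩ := hx
    obtain ⟨c', m', n', rfl⟩ := hy
    refine ⟨c ⊞ c', M.obj.map biprod.fst.op m + M.obj.map biprod.snd.op m',
      N.obj.map biprod.inl n + N.obj.map biprod.inr n', ?_⟩
    rw [ModTensor.tmul_add, ← ModTensor.map_tmul, ← ModTensor.map_tmul, map_add, map_add,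
      ← map_comp_apply, ← map_comp_apply, ← map_comp_apply, ← map_comp_apply, biprod.inl_fst,
      biprod.inl_snd, biprod.inr_fst, biprod.inr_snd, map_id_apply, map_id_apply,
      map_zero_apply, map_zero_apply, add_zero, zero_add]

lemma isFlatMod_of_isFiltered [HasZeroObject C] [HasBinaryBiproducts C] (M : RightMod C)
    [IsFiltered (El M)] : IsFlatMod M := by
  intro N N' φ hφ
  rw [injective_iff_map_eq_zero]
  intro x hx
  obtain ⟨c, m, n, rfl⟩ := exists_eq_tmul x
  rw [ModTensor.modTensorMap_tmul] at hx
  obtain ⟨d, f, m', rfl, hn⟩ := exists_of_tmul_eq_zero _ _ hx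
  have : N.obj.map f n = 0 := hφ d (by
    rw [map_zero, ← hn]
    exact NatTrans.naturality_apply φ.hom f n)
  rw [ModTensor.map_tmul, this, ModTensor.tmul_zero]

end RightMod

end FlatHomological

section Triangulated

variable {C : Type u} [Category.{v} C] [HasZeroObject C] [HasShift C ℤ] [Preadditive C]
  [∀ k : ℤ, (CategoryTheory.shiftFunctor C k).Additive] [Pretriangulated C]

open Opposite Pretriangulated

namespace RightMod

/-- The category of elements of a homological functor is filtered: two parallel morphisms `f` and
`g` are coequalized by the cone of `f - g`. -/
lemma isFiltered_el {M : RightMod C} (hM : M.obj.IsHomological) : IsFiltered (El M) where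
  nonempty := ⟨⟨0, 0⟩⟩
  cocone_objs := by
    rintro ⟨c, m⟩ ⟨d, m'⟩
    refine ⟨⟨c ⊞ d, M.obj.map biprod.fst.op m + M.obj.map biprod.snd.op m'⟩,
      ⟨biprod.inl, ?_⟩, ⟨biprod.inr, ?_⟩, trivial⟩
    · rw [map_add, ← map_comp_apply, ← map_comp_apply, biprod.inl_fst, biprod.inl_snd,
        map_id_apply, map_zero_apply, add_zero]
    · rw [map_add, ← map_comp_apply, ← map_comp_apply, biprod.inr_fst, biprod.inr_snd,
        map_id_apply, map_zero_apply, zero_add]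
  cocone_maps := by
    rintro ⟨c, m⟩ ⟨d, m'⟩ ⟨f, hf⟩ ⟨g, hg⟩
    obtain ⟨e, k, t, hT⟩ := distinguished_cocone_triangle (f - g)
    obtain ⟨m'', hm''⟩ := exists_map_mor₂ hM hT m' (by
      refine (map_sub_apply M f g m').trans ?_
      rw [hf, hg]
      exact sub_self m)
    refine ⟨⟨e, m''⟩, ⟨k, hm''⟩, ULift.ext _ _ (Subtype.ext ?_)⟩
    have : (f - g) ≫ k = 0 := comp_distTriang_mor_zero₁₂ _ hT
    rwa [Preadditive.sub_comp, sub_eq_zero] at this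

lemma isFlatMod_iff_isHomological (M : RightMod C) : IsFlatMod M ↔ M.obj.IsHomological := by
  constructor
  · intro hM
    rw [isHomological_iff]
    intro T hT y hy
    exact exists_map_eq_of_isFlatMod hM T.mor₁ T.mor₂
      (fun c h hh => Triangle.yoneda_exact₂ T hT h hh) y hy
  · intro hM
    have := isFiltered_el hM
    exact M.isFlatMod_of_isFiltered

end RightMod

end Triangulated

theorem theorem6p1 {C : Type u} [Category.{v} C] [HasZeroObject C] [HasShift C ℤ]
    [Preadditive C] [∀ k : ℤ, (CategoryTheory.shiftFunctor C k).Additive]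
    [Pretriangulated C] [IsTriangulated C]
    (n : ℕ) (hC : Cardinal.mk (Arrow (Skeleton C)) ≤ Cardinal.aleph n) :
    (∃ m : ℕ, m ≤ n + 1 ∧ IsGorensteinOfDim.{v} (RightMod C) m) ∧
    (∀ M : RightMod C, HasFiniteProjDim M ↔ IsFlatMod M) ∧
    (∀ M : RightMod C, IsFlatMod M ↔ M.obj.IsHomological) := by
  obtain ⟨ι, X, hX, hn⟩ := exists_small_family hC
  have := RightMod.isGrothendieckAbelian hX
  have := RightMod.enoughProjectives hX
  have := IsGrothendieckAbelian.enoughInjectives (C := RightMod C)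
  have hid (M : RightMod C) (hM : M.obj.IsHomological) : HasInjectiveDimensionLE M (n + 1) :=
    RightMod.hasInjectiveDimensionLE_of_isHomological hX hn hM
  have hpd (M : RightMod C) (hM : M.obj.IsHomological) : HasProjectiveDimensionLE M (n + 1) :=
    hasProjectiveDimensionLE_of_injDim (fun M : RightMod C => M.obj.IsHomological) (n + 1)
      (fun S hS _ h₃ => RightMod.isHomological_X₁ hS
        (RightMod.isHomological_of_projective _ hX) h₃)
      (fun e h => RightMod.isHomological_of_retract h e.inv e.hom e.inv_hom_id) hid hM
  have hp (M : RightMod C) : HasFiniteProjDim M ↔ M.obj.IsHomological :=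
    ⟨RightMod.isHomological_of_hasFiniteProjDim hX, fun h => ⟨_, hpd M h⟩⟩
  have hi (M : RightMod C) : HasFiniteInjDim M ↔ M.obj.IsHomological :=
    ⟨RightMod.isHomological_of_hasFiniteInjDim, fun h => ⟨_, hid M h⟩⟩
  refine ⟨?_, fun M => (hp M).trans M.isFlatMod_iff_isHomological.symm,
    RightMod.isFlatMod_iff_isHomological⟩
  exact exists_isGorensteinOfDim (fun M => (hp M).trans (hi M).symm)
    (fun M hM => hpd M ((hp M).1 hM)) (RightMod.free.isSeparator hX)
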